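/- Let $d\in\mathbb N$, $D=2d$, and write points of $\mathbb R^D$ as $x=(p,q)$ with $p,q\in\mathbb R^d$. Let $W\in C_c^2(\mathbb R^d)$ be even, $\Phi\in C^2(\mathbb R^d)$, $\varepsilon>0$, $\alpha_0>0$, $0<T<\infty$, and let $\mu_0$ be a finite Borel measure on $\mathbb R^D$ with $\int e^{\alpha_0|x|}\,d\mu_0<\infty$. For a finite Borel measure $\mu$ on $\mathbb R^D$ put $(W*\mu)(q)=\int W(q-q')\,d\mu(p',q')$ and $$V_\mu(p,q)=J\nabla_W\mathscr H(\mu)(p,q)=\bigl(-\nabla(W*\mu+\Phi)(q),\,p\bigr).$$ For a velocity field $v=(v_s)$ on $\mathbb R^D$ and $t\ge 0$, let $\mathbb S_t$ be the set of $x\in\mathbb R^D$ for which $\dot X_s=v_s(X_s)$, $X_0=x$ has a solution on all of $[0,t]$ (that is, $X$ is continuous, $s\mapsto v_s(X_s)$ is integrable, and $X_s=x+\int_0^s v_r(X_r)\,dr$ for $s\in[0,t]$). For $x\in\mathbb S_t$ let $X_t(x)$ be the value at time $t$ of this solution (which is unique for the fields used below), and define $R_t$ by $R_t\circ X_t(x)=\exp\bigl(-\int_0^t\varepsilon|\dot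 X_s(x)|\,ds\bigr)$, $x\in\mathbb S_t$. The deficient transport of a measure $\mu$ by $v$ for time $t$ is the measure $\nu$ with $\int\psi\,d\nu=\int_{\mathbb S_t}(R_t\psi)\circ X_t\,d\mu$. For $n\ge1$ and $h=T/n$, let $\mu_0^{\varepsilon,n}=\mu_0$ and, for $t\in[kh,(k+1)h]$, let $\mu_t^{\varepsilon,n}$ be the deficient transport of $\mu_{kh}^{\varepsilon,n}$ for time $t-kh$ by the time-independent field $V_{\mu_{kh}^{\varepsilon,n}}$. Let $(\mu_t^\varepsilon)_{t\in[0,T]}$ be finite Borel measures such that, for some strictly increasing sequence $(n_k)$ and every $t\in[0,T]$, $\int\varphi\,d\mu_t^{\varepsilon,n_k}\to\int\varphi\,d\mu_t^\varepsilon$ for all $\varphi\in C_c^\infty(\mathbb R^D)$. (This is the construction of the solution of the deficient Hamiltonian ODE $\partial_t\mu_t^\varepsilon+\nabla\cdot(J\nabla_W\mathscr H(\mu_t^\varepsilon)\mu_t^\varepsilon)=-\varepsilon|J\nabla_W\mathscr H(\mu_t^\varepsilon)|\mu_t^\varepsilon$.) Let $\mathbb S_t^\varepsilon$, $X_t^\varepsilon$,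 $R_t^\varepsilon$ be the objects defined above for the limiting velocity field $v_s^\varepsilon=V_{\mu_s^\varepsilon}$. Then for every $t\in(0,T]$ the set $\mathbb S_t^\varepsilon$ is open, and for every $\varphi\in C_c^\infty(\mathbb R^D)$ the function $(\varphi\cdot R_t^\varepsilon)\circ X_t^\varepsilon$ is $\mu_0$-integrable on $\mathbb S_t^\varepsilon$ and $$\int_{\mathbb R^D}\varphi\,d\mu_t^\varepsilon=\int_{\mathbb S_t^\varepsilon}(\varphi\cdot R_t^\varepsilon)\circ X_t^\varepsilon\,d\mu_0 .$$ -/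

import Mathlib

open MeasureTheory Filter Topology
open scoped ContDiff

noncomputable section

namespace DeficientHamiltonian

/-- Configuration space `ℝᵈ` with its Euclidean norm. -/
abbrev Config (d : ℕ) : Type := EuclideanSpace ℝ (Fin d)

/-- Phase space `ℝᴰ`, `D = 2d`, of points `x = (p, q)` with `‖(p, q)‖² = ‖p‖² + ‖q‖²`;
`x.fst` is the first entry `p` and `x.snd` is the second entry `q`. -/
abbrev Phase (d : ℕ) : Type := WithLp 2 (Config d × Config d)

variable {d : ℕ}

/-- The `α`-exponential moment `M_α(μ) = ∫ exp (α |x|) dμ(x)`. -/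
def expMoment (α : ℝ) (μ : Measure (Phase d)) : ENNReal :=
  ∫⁻ x, ENNReal.ofReal (Real.exp (α * ‖x‖)) ∂μ

/-- The mean-field potential `(W * μ)(q) = ∫ W (q - q') dμ(p', q')`. -/
def meanField (W : Config d → ℝ) (μ : Measure (Phase d)) (q : Config d) : ℝ :=
  ∫ x, W (q - x.snd) ∂μ

/-- The Wasserstein gradient of the Hamiltonian
`½ ∫ |p|² dμ + ½ ∫ (W * μ) dμ + ∫ Φ dμ`, that is `(p, q) ↦ (p, ∇(W * μ + Φ)(q))`. -/
def wassersteinGradient (W Φ : Config d → ℝ) (μ : Measure (Phase d)) (x : Phase d) : Phase d :=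
  WithLp.toLp 2 (x.fst, gradient (fun q => meanField W μ q + Φ q) x.snd)

/-- The symplectic map `J (p, q) = (-q, p)`. -/
def symplecticJ (x : Phase d) : Phase d :=
  WithLp.toLp 2 (-x.snd, x.fst)

/-- The Hamiltonian velocity field `(p, q) ↦ (-∇(W * μ + Φ)(q), p)` generated by `μ`. -/
def hamVelocity (W Φ : Config d → ℝ) (μ : Measure (Phase d)) (x : Phase d) : Phase d :=
  symplecticJ (wassersteinGradient W Φ μ x)

/-- `X` solves `Ẋ_s = v_s(X_s)`, `X_0 = x`, on the closed interval `[0, t]` (in the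
Carathéodory sense: `X` is continuous and satisfies the integrated equation). -/
structure IsSolutionOn (v : ℝ → Phase d → Phase d) (x : Phase d) (t : ℝ) (X : ℝ → Phase d) :
    Prop where
  continuousOn : ContinuousOn X (Set.Icc 0 t)
  intervalIntegrable : IntervalIntegrable (fun r => v r (X r)) volume 0 t
  eq_integral : ∀ s ∈ Set.Icc 0 t, X s = x + ∫ r in (0 : ℝ)..s, v r (X r)

/-- The set `𝕊_t` of initial points whose trajectory has not reached infinity by time `t`: those
for which the equation has a solution on all of `[0, t]`.  If `v` is defined beyond time `t`, this
is the set where the maximal existence time exceeds `t`; the closed interval also gives the right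
set when `t` is the last time at which `v` is defined. -/
def survivors (v : ℝ → Phase d → Phase d) (t : ℝ) : Set (Phase d) :=
  {x | ∃ X : ℝ → Phase d, IsSolutionOn v x t X}

open Classical in
/-- The flow `X_t(x)`: the value at time `t` of the solution started at `x`, for `x ∈ 𝕊_t` (the
solution is unique for the locally Lipschitz fields considered here); the junk value off `𝕊_t`
is `x`. -/
def flow (v : ℝ → Phase d → Phase d) (t : ℝ) (x : Phase d) : Phase d :=
  if h : ∃ X : ℝ → Phase d, IsSolutionOn v x t X then h.choose t else x

/-- The mass-degradation weight `R_t ∘ X_t`, as a function of the initial point `x ∈ 𝕊_t`: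
`R_t(X_t(x)) = exp (-∫₀ᵗ ε |Ẋ_s(x)| ds)`, where `Ẋ_s(x) = v_s(X_s(x))`. -/
def weightAlongFlow (v : ℝ → Phase d → Phase d) (ε t : ℝ) (x : Phase d) : ℝ :=
  Real.exp (-∫ s in (0 : ℝ)..t, ε * ‖v s (flow v s x)‖)

/-- The solution at time `t` of the deficient continuity equation
`∂_t μ_t + ∇ · (v_t μ_t) = -ε |v_t| μ_t` with initial datum `μ` that is transported by the flow:
`∫ ψ dμ_t = ∫_{𝕊_t} (R_t ψ) ∘ X_t dμ`. -/
def deficientTransport (v : ℝ → Phase d → Phase d) (ε t : ℝ) (μ : Measure (Phase d)) :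
    Measure (Phase d) :=
  Measure.map (flow v t)
    ((μ.restrict (survivors v t)).withDensity
      (fun x => ENNReal.ofReal (weightAlongFlow v ε t x)))

/-- The discretized measures at the grid times `k h`: over each step of length `h` the measure
is transported by the velocity field frozen at the beginning of the step. -/
def gridMeasure (W Φ : Config d → ℝ) (ε h : ℝ) (μ₀ : Measure (Phase d)) : ℕ → Measure (Phase d)
  | 0 => μ₀
  | k + 1 =>
      deficientTransport (fun _ => hamVelocity W Φ (gridMeasure W Φ ε h μ₀ k)) ε h
        (gridMeasure W Φ ε h μ₀ k)

/-- The time-discretized measures `μ_t^{ε,n}` with step `h = T / n`: on `[k h, (k + 1) h)` the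
measure is transported, from time `k h` on, by the field frozen at time `k h`. -/
def discretized (W Φ : Config d → ℝ) (ε T : ℝ) (μ₀ : Measure (Phase d)) (n : ℕ) (t : ℝ) :
    Measure (Phase d) :=
  let h : ℝ := T / n
  let k : ℕ := ⌊t / h⌋₊
  deficientTransport (fun _ => hamVelocity W Φ (gridMeasure W Φ ε h μ₀ k)) ε (t - k * h)
    (gridMeasure W Φ ε h μ₀ k)

/-- Convergence of measures in the sense of distributions, against `C_c^∞(ℝᴰ)`. -/
def DistribTendsto (ν : ℕ → Measure (Phase d)) (μ : Measure (Phase d)) : Prop :=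
  ∀ φ : Phase d → ℝ, ContDiff ℝ ∞ φ → HasCompactSupport φ →
    Tendsto (fun k => ∫ x, φ x ∂(ν k)) atTop (𝓝 (∫ x, φ x ∂μ))

/-- `(μ_t)_{t ∈ [0, T]}` is a path of finite measures constructed by the discretization scheme:
along some subsequence `n_k` the measures `μ_t^{ε,n_k}` converge to `μ_t` in the sense of
distributions, for every `t ∈ [0, T]`. -/
def IsConstructedSolution (W Φ : Config d → ℝ) (ε T : ℝ) (μ₀ : Measure (Phase d))
    (μ : ℝ → Measure (Phase d)) : Prop :=
  (∀ t ∈ Set.Icc 0 T, IsFiniteMeasure (μ t)) ∧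
    ∃ n : ℕ → ℕ, StrictMono n ∧ ∀ t ∈ Set.Icc 0 T,
      DistribTendsto (fun k => discretized W Φ ε T μ₀ (n k) t) (μ t)

end DeficientHamiltonian

end

/-! The weight of a trajectory is `exp (-ε · length)`, and its displacement is at most its length.
This one fact is used twice.

Compactness: for `0 ≤ α ≤ ε` the product of `exp (α‖x‖)` and the weight does not grow along
trajectories, so with `α = min α₀ ε` the exponential moment of every grid measure is at most that of
`μ₀` (`expMoment_deficientTransport_le`). The grid measures are therefore uniformly tight. A
short-time estimate (`norm_integral_deficientTransport_sub_le`) gives them the same distributional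
limit as the discretized measures. Since `∇W` is bounded and continuous, the frozen fields converge
pointwise to the limiting field (`tendsto_stepField`).

Explosion: by the semigroup property, each discretized measure is a single deficient transport of
`μ₀` by a field that is piecewise constant in time (`discretized_eq`). All these fields share bounds
and Lipschitz constants on balls, since these depend on the measure only through its mass. If the
limiting trajectory of `x` survives, Grönwall gives convergence of flows and weights at `x`. If it
explodes, the approximating trajectories leave every ball before `t` or die, so they are arbitrarily
long and their weights tend to `0`. Dominated convergence against `μ₀`
(`tendsto_integral_deficientTransport`) and uniqueness of limits give the formula. Openness of the
survivor set is the same stability applied to a constant family of fields. -/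

namespace DeficientHamiltonian

open Set

/-! ### Grönwall's inequality, locally controlled fields and radial truncation. -/

/-- Integral form of Grönwall's inequality. -/
theorem le_mul_exp_of_le_add_integral {u : ℝ → ℝ} {δ K t : ℝ} (hu : ContinuousOn u (Icc 0 t))
    (hu0 : ∀ s ∈ Icc 0 t, 0 ≤ u s) (hδ : 0 ≤ δ) (hK : 0 ≤ K)
    (h : ∀ s ∈ Icc 0 t, u s ≤ δ + K * ∫ r in (0 : ℝ)..s, u r) :
    ∀ s ∈ Icc 0 t, u s ≤ δ * Real.exp (K * s) := by
  intro s hs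
  have ht : 0 ≤ t := hs.1.trans hs.2
  -- A continuous extension of `u` to the line makes the primitive differentiable everywhere. The
  -- differential Grönwall inequality then applies to the majorant `δ + K ∫ w`, whose derivative `K
  -- w` is at most `K` times itself.
  set w : ℝ → ℝ := IccExtend ht ((Icc 0 t).domRestrict u) with hw
  have hwc : Continuous w := hu.domRestrict.Icc_extend'
  have hwu : ∀ r ∈ Icc 0 t, w r = u r := fun r hr => by
    rw [hw, IccExtend_of_mem ht _ hr, domRestrict_apply]
  have hw0 : ∀ r, 0 ≤ w r := fun r => hu0 _ (projIcc 0 t ht r).2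
  have hint : ∀ r ∈ Icc 0 t, ∫ z in (0 : ℝ)..r, u z = ∫ z in (0 : ℝ)..r, w z := fun r hr =>
    intervalIntegral.integral_congr fun z hz => by
      rw [uIcc_of_le hr.1] at hz
      exact (hwu z ⟨hz.1, hz.2.trans hr.2⟩).symm
  have hd : ∀ r, HasDerivAt (fun r => δ + K * ∫ z in (0 : ℝ)..r, w z) (K * w r) r := fun r =>
    ((hwc.integral_hasStrictDerivAt 0 r).hasDerivAt.const_mul K).const_add δ
  have hF0 : ∀ r, 0 ≤ r → 0 ≤ ∫ z in (0 : ℝ)..r, w z := fun r hr =>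
    intervalIntegral.integral_nonneg hr fun z _ => hw0 z
  have key := norm_le_gronwallBound_of_norm_deriv_right_le (δ := δ) (K := K) (ε := 0)
    (a := 0) (b := t) (f := fun r => δ + K * ∫ z in (0 : ℝ)..r, w z) (f' := fun r => K * w r)
    (fun r _ => (hd r).continuousAt.continuousWithinAt) (fun r _ => (hd r).hasDerivWithinAt)
    (by simp [abs_of_nonneg hδ]) (fun r hr => by
      have hr' : r ∈ Icc 0 t := Ico_subset_Icc_self hr
      have h1 := h r hr'
      rw [hint r hr', ← hwu r hr'] at h1
      have h2 := hF0 r hr.1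
      rw [Real.norm_of_nonneg (mul_nonneg hK (hw0 r)), Real.norm_of_nonneg (by positivity), add_zero]
      exact mul_le_mul_of_nonneg_left h1 hK) s hs
  rw [gronwallBound_ε0, sub_zero] at key
  refine (h s hs).trans ?_
  rw [hint s hs]
  exact (le_abs_self _).trans key

variable {d : ℕ}

/-- A velocity field which is measurable in time and, uniformly in time, bounded by `C R` and
Lipschitz with constant `K R` on the ball of radius `R`. -/
structure LocallyControlled (v : ℝ → Phase d → Phase d) (C K : ℝ → ℝ) : Prop where
  measurable : ∀ x, Measurable fun s => v s x
  bound : ∀ R s x, ‖x‖ ≤ R → ‖v s x‖ ≤ C R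
  lipschitz : ∀ R s x y, ‖x‖ ≤ R → ‖y‖ ≤ R → ‖v s x - v s y‖ ≤ K R * ‖x - y‖
  nonneg : ∀ R, 0 ≤ K R

namespace LocallyControlled

variable {v : ℝ → Phase d → Phase d} {C K : ℝ → ℝ}

theorem continuous (hv : LocallyControlled v C K) (s : ℝ) : Continuous (v s) := by
  rw [continuous_iff_continuousAt]
  intro x
  have hK := hv.nonneg (‖x‖ + 1)
  rw [ContinuousAt, tendsto_iff_norm_sub_tendsto_zero]
  have hb : ∀ᶠ y in 𝓝 x, ‖y‖ ≤ ‖x‖ + 1 :=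
    (continuous_norm.tendsto x).eventually_le_const (by linarith)
  refine squeeze_zero' (Eventually.of_forall fun _ => norm_nonneg _)
    (hb.mono fun y hy => hv.lipschitz (‖x‖ + 1) s y x hy (by linarith)) ?_
  have : Tendsto (fun y => K (‖x‖ + 1) * ‖y - x‖) (𝓝 x) (𝓝 (K (‖x‖ + 1) * ‖x - x‖)) :=
    (by fun_prop : Continuous fun y => K (‖x‖ + 1) * ‖y - x‖).tendsto x
  simpa using this

theorem measurable_uncurry (hv : LocallyControlled v C K) :
    Measurable fun z : ℝ × Phase d => v z.1 z.2 := by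
  have h2 := measurable_uncurry_of_continuous_of_measurable (ι := Phase d) (α := ℝ)
    (u := fun x s => v s x) (fun s => hv.continuous s) hv.measurable
  exact h2.comp measurable_swap

theorem shift (hv : LocallyControlled v C K) (τ : ℝ) :
    LocallyControlled (fun s => v (τ + s)) C K where
  measurable x := (hv.measurable x).comp (measurable_const_add τ)
  bound R _ x := hv.bound R _ x
  lipschitz R _ x y := hv.lipschitz R _ x y
  nonneg := hv.nonneg

theorem intervalIntegrable (hv : LocallyControlled v C K) {X : ℝ → Phase d} {t : ℝ}
    (hX : ContinuousOn X (Icc 0 t)) (ht : 0 ≤ t) :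
    IntervalIntegrable (fun r => v r (X r)) volume 0 t := by
  obtain ⟨R, hR⟩ := isCompact_Icc.exists_bound_of_continuousOn hX
  rw [intervalIntegrable_iff_integrableOn_Icc_of_le ht]
  refine IntegrableOn.of_bound (by simp) ?_ (C R) ?_
  · have h1 : AEMeasurable X (volume.restrict (Icc 0 t)) := hX.aemeasurable measurableSet_Icc
    exact (hv.measurable_uncurry.comp_aemeasurable
      (aemeasurable_id.prodMk h1)).aestronglyMeasurable
  · exact (ae_restrict_mem measurableSet_Icc).mono fun r hr => hv.bound R r _ (hR r hr)

/-- No regularity of `s ↦ μ s` is assumed, so measurability in time of the limiting field comes from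
its being a pointwise limit. -/
theorem of_tendsto {v' : ℕ → ℝ → Phase d → Phase d} (hv : ∀ n, LocallyControlled (v' n) C K)
    (h : ∀ s x, Tendsto (fun n => v' n s x) atTop (𝓝 (v s x))) : LocallyControlled v C K where
  measurable x := measurable_of_tendsto_metrizable (fun n => (hv n).measurable x)
    (tendsto_pi_nhds.2 fun s => h s x)
  bound R s x hx := le_of_tendsto (h s x).norm (Eventually.of_forall fun n => (hv n).bound R s x hx)
  lipschitz R s x y hx hy := le_of_tendsto ((h s x).sub (h s y)).norm
    (Eventually.of_forall fun n => (hv n).lipschitz R s x y hx hy)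
  nonneg := (hv 0).nonneg

theorem indicator (hv : LocallyControlled v C K) (hC : ∀ R, 0 ≤ C R) {S : Set ℝ}
    (hS : MeasurableSet S) : LocallyControlled (S.indicator v) C K where
  measurable x := by
    convert (hv.measurable x).indicator hS using 2 with s
    by_cases h : s ∈ S <;> simp [h]
  bound R s x hx := by
    by_cases h : s ∈ S
    · simpa [h] using hv.bound R s x hx
    · simpa [h] using hC R
  lipschitz R s x y hx hy := by
    by_cases h : s ∈ S
    · simpa [h] using hv.lipschitz R s x y hx hy
    · simpa [h] using mul_nonneg (hv.nonneg R) (norm_nonneg _)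
  nonneg := hv.nonneg

end LocallyControlled

/-- The radial retraction of phase space onto the closed ball of radius `R`. -/
noncomputable def radialRetraction (R : ℝ) (x : Phase d) : Phase d := (R / max R ‖x‖) • x

theorem norm_radialRetraction_le {R : ℝ} (hR : 0 < R) (x : Phase d) :
    ‖radialRetraction R x‖ ≤ R := by
  have h : 0 < max R ‖x‖ := lt_max_of_lt_left hR
  rw [radialRetraction, norm_smul, Real.norm_of_nonneg (by positivity), div_mul_eq_mul_div,
    div_le_iff₀ h]
  exact mul_le_mul_of_nonneg_left (le_max_right _ _) hR.le

theorem radialRetraction_of_norm_le {R : ℝ} (hR : 0 < R) {x : Phase d} (hx : ‖x‖ ≤ R) :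
    radialRetraction R x = x := by
  rw [radialRetraction, max_eq_left hx, div_self hR.ne', one_smul]

theorem norm_radialRetraction_sub_le {R : ℝ} (hR : 0 < R) (x y : Phase d) :
    ‖radialRetraction R x - radialRetraction R y‖ ≤ 2 * ‖x - y‖ := by
  have ha : 0 < max R ‖x‖ := lt_max_of_lt_left hR
  have hb : 0 < max R ‖y‖ := lt_max_of_lt_left hR
  set a := max R ‖x‖ with hadef
  set b := max R ‖y‖ with hbdef
  have hab : |b - a| ≤ ‖x - y‖ := by
    calc |b - a| ≤ |‖y‖ - ‖x‖| := by
          simpa using abs_max_sub_max_le_max R ‖y‖ R ‖x‖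
      _ ≤ ‖x - y‖ := by rw [norm_sub_rev]; exact abs_norm_sub_norm_le y x
  -- Each of the two terms is at most `‖x - y‖`, whence the constant `2`; it is not sharp, but any
  -- constant would do.
  have e : radialRetraction R x - radialRetraction R y
      = (R / a) • (x - y) + (R / a * ((b - a) / b)) • y := by
    have : R / a * ((b - a) / b) = R / a - R / b := by field_simp
    rw [this, smul_sub, sub_smul]; simp only [radialRetraction]; abel
  have hRa : R / a ≤ 1 := (div_le_one ha).2 (le_max_left _ _)
  have hyb : ‖y‖ / b ≤ 1 := (div_le_one hb).2 (le_max_right _ _)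
  rw [e]
  refine (norm_add_le _ _).trans ?_
  rw [norm_smul, norm_smul, Real.norm_of_nonneg (by positivity), norm_mul,
    Real.norm_of_nonneg (show 0 ≤ R / a by positivity), norm_div, Real.norm_eq_abs,
    Real.norm_of_nonneg hb.le]
  have h1 : R / a * ‖x - y‖ ≤ 1 * ‖x - y‖ := by gcongr
  have h2 : R / a * (|b - a| / b) * ‖y‖ ≤ 1 * (‖x - y‖ * 1) := by
    calc R / a * (|b - a| / b) * ‖y‖ = R / a * (|b - a| * (‖y‖ / b)) := by ring
      _ ≤ _ := by gcongr
  linarith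

/-- The truncated field is globally bounded and Lipschitz, so it has global solutions. As long as
these stay in the ball of radius `R` they solve the original equation. -/
theorem LocallyControlled.comp_radialRetraction {v : ℝ → Phase d → Phase d} {C K : ℝ → ℝ}
    (hv : LocallyControlled v C K) {R : ℝ} (hR : 0 < R) :
    LocallyControlled (fun s x => v s (radialRetraction R x)) (fun _ => C R)
      (fun _ => K R * 2) where
  measurable x := hv.measurable _
  bound _ s x _ := hv.bound R s _ (norm_radialRetraction_le hR x)
  lipschitz _ s x y _ _ := by
    refine (hv.lipschitz R s _ _ (norm_radialRetraction_le hR x)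
      (norm_radialRetraction_le hR y)).trans ?_
    rw [mul_assoc]
    exact mul_le_mul_of_nonneg_left (norm_radialRetraction_sub_le hR x y) (hv.nonneg R)
  nonneg _ := mul_nonneg (hv.nonneg R) zero_le_two

end DeficientHamiltonian

/-! ### Carathéodory solutions: gluing, stability, uniqueness and existence. -/

namespace DeficientHamiltonian

open Set

variable {d : ℕ}

namespace IsSolutionOn

variable {v w : ℝ → Phase d → Phase d} {x y : Phase d} {t τ : ℝ} {X Y : ℝ → Phase d}

theorem apply_zero (hX : IsSolutionOn v x t X) (ht : 0 ≤ t) : X 0 = x := by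
  simpa using hX.eq_integral 0 ⟨le_rfl, ht⟩

theorem mono (hX : IsSolutionOn v x t X) (h0 : 0 ≤ τ) (hτ : τ ≤ t) : IsSolutionOn v x τ X where
  continuousOn := hX.continuousOn.mono (Icc_subset_Icc_right hτ)
  intervalIntegrable := hX.intervalIntegrable.mono_set (by
    rw [uIcc_of_le h0, uIcc_of_le (h0.trans hτ)]; exact Icc_subset_Icc_right hτ)
  eq_integral s hs := hX.eq_integral s ⟨hs.1, hs.2.trans hτ⟩

theorem intervalIntegrable_of_mem (hX : IsSolutionOn v x t X) {a b : ℝ} (ha : a ∈ Icc 0 t)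
    (hb : b ∈ Icc 0 t) : IntervalIntegrable (fun r => v r (X r)) volume a b :=
  hX.intervalIntegrable.mono_set (by
    rw [uIcc_of_le (ha.1.trans ha.2)]; exact uIcc_subset_Icc ha hb)

theorem sub_eq_integral (hX : IsSolutionOn v x t X) {a b : ℝ} (ha : a ∈ Icc 0 t)
    (hb : b ∈ Icc 0 t) : X b - X a = ∫ r in a..b, v r (X r) := by
  have h0 : (0 : ℝ) ∈ Icc 0 t := ⟨le_rfl, ha.1.trans ha.2⟩
  rw [hX.eq_integral b hb, hX.eq_integral a ha, add_sub_add_left_eq_sub,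
    intervalIntegral.integral_interval_sub_left (hX.intervalIntegrable_of_mem h0 hb)
      (hX.intervalIntegrable_of_mem h0 ha)]

/-- The solution property only involves the field along the trajectory at almost every time. -/
theorem of_eqOn (hX : IsSolutionOn v x t X) (ht : 0 ≤ t)
    (h : ∀ r ∈ Ico 0 t, w r (X r) = v r (X r)) : IsSolutionOn w x t X where
  continuousOn := hX.continuousOn
  intervalIntegrable := by
    have := hX.intervalIntegrable
    rw [intervalIntegrable_iff_integrableOn_Ico_of_le ht] at this ⊢
    exact this.congr_fun (fun r hr => (h r hr).symm) measurableSet_Ico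
  eq_integral s hs := by
    rw [hX.eq_integral s hs, intervalIntegral.integral_of_le hs.1,
      intervalIntegral.integral_of_le hs.1, ← integral_Ico_eq_integral_Ioc,
      ← integral_Ico_eq_integral_Ioc, setIntegral_congr_fun measurableSet_Ico
        (fun r hr => (h r ⟨hr.1, hr.2.trans_le hs.2⟩).symm)]

theorem congr (hX : IsSolutionOn v x t X) (ht : 0 ≤ t) (h : ∀ r ∈ Icc 0 t, Y r = X r) :
    IsSolutionOn v x t Y where
  continuousOn := hX.continuousOn.congr h
  intervalIntegrable := hX.intervalIntegrable.congr fun r hr => by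
    rw [uIoc_of_le ht] at hr
    simp only [h r (Ioc_subset_Icc_self hr)]
  eq_integral s hs := by
    rw [h s hs, hX.eq_integral s hs]
    congr 1
    refine intervalIntegral.integral_congr fun r hr => ?_
    rw [uIcc_of_le hs.1] at hr
    simp only [h r ⟨hr.1, hr.2.trans hs.2⟩]

theorem shift (hX : IsSolutionOn v x (τ + t) X) (hτ : 0 ≤ τ) (ht : 0 ≤ t) :
    IsSolutionOn (fun s => v (τ + s)) (X τ) t (fun s => X (τ + s)) where
  continuousOn := hX.continuousOn.comp (by fun_prop) fun s hs =>
    ⟨add_nonneg hτ hs.1, by linarith [hs.2]⟩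
  intervalIntegrable := by
    have h := (hX.intervalIntegrable_of_mem (a := τ) (b := τ + t) ⟨hτ, by linarith⟩
      ⟨by linarith, le_rfl⟩).comp_add_left τ
    simpa using h
  eq_integral s hs := by
    have h := hX.sub_eq_integral (a := τ) (b := τ + s) ⟨hτ, by linarith⟩
      ⟨by linarith [hs.1], by linarith [hs.2]⟩
    have h2 := intervalIntegral.integral_comp_add_left (a := 0) (b := s)
      (fun r => v r (X r)) τ
    rw [h2, add_zero, ← h, add_sub_cancel]

theorem concat (hX : IsSolutionOn v x τ X)
    (hY : IsSolutionOn (fun s => v (τ + s)) (X τ) t Y) (hτ : 0 ≤ τ) (ht : 0 ≤ t) :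
    IsSolutionOn v x (τ + t) (fun r => if r ≤ τ then X r else Y (r - τ)) := by
  set Z : ℝ → Phase d := fun r => if r ≤ τ then X r else Y (r - τ) with hZ
  have hZX : ∀ r ∈ Icc 0 τ, Z r = X r := fun r hr => if_pos hr.2
  have hZY : ∀ r ∈ Icc 0 t, Z (τ + r) = Y r := fun r hr => by
    rcases hr.1.eq_or_lt with h | h
    · subst h; simp [hZ, hY.apply_zero ht]
    · simp [hZ, h]
  have hZY' : ∀ r ∈ Icc τ (τ + t), Z r = Y (r - τ) := fun r hr => by
    have := hZY (r - τ) ⟨by linarith [hr.1], by linarith [hr.2]⟩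
    rwa [add_sub_cancel] at this
  have h1 := hX.congr hτ hZX
  have h2 := hY.congr ht (Y := fun r => Z (τ + r)) hZY
  have hi2 : IntervalIntegrable (fun r => v r (Z r)) volume τ (τ + t) := by
    have := h2.intervalIntegrable.comp_sub_right τ
    simpa [add_comm t τ] using this
  refine ⟨?_, h1.intervalIntegrable.trans hi2, ?_⟩
  · have : Icc 0 (τ + t) = Icc 0 τ ∪ Icc τ (τ + t) :=
      (Icc_union_Icc_eq_Icc hτ (by linarith)).symm
    rw [this]
    refine h1.continuousOn.union_of_isClosed ?_ isClosed_Icc isClosed_Icc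
    refine ContinuousOn.congr (f := fun r => Y (r - τ)) ?_ hZY'
    exact hY.continuousOn.comp (by fun_prop) fun r hr =>
      ⟨by linarith [hr.1], by linarith [hr.2]⟩
  · intro s hs
    rcases le_total s τ with h | h
    · exact h1.eq_integral s ⟨hs.1, h⟩
    · have hm : s - τ ∈ Icc 0 t := ⟨by linarith, by linarith [hs.2]⟩
      have e2 := h2.eq_integral (s - τ) hm
      have h3 := intervalIntegral.integral_comp_add_left (a := 0) (b := s - τ)
        (fun r => v r (Z r)) τ
      rw [h3] at e2
      simp only [add_sub_cancel, add_zero] at e2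
      have e1 := h1.eq_integral τ ⟨hτ, le_rfl⟩
      rw [hZX τ ⟨hτ, le_rfl⟩] at e1
      rw [e2, e1, add_assoc, intervalIntegral.integral_add_adjacent_intervals
        h1.intervalIntegrable]
      exact hi2.mono_set (by
        rw [uIcc_of_le h, uIcc_of_le (by linarith)]; exact Icc_subset_Icc_right hs.2)

/-- Stability of solutions with respect to the initial point and the field. -/
theorem norm_sub_le (hX : IsSolutionOn v x t X) (hY : IsSolutionOn w y t Y) {K : ℝ} (hK : 0 ≤ K)
    (hlip : ∀ s ∈ Icc 0 t, ‖v s (X s) - v s (Y s)‖ ≤ K * ‖X s - Y s‖)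
    (hint : IntervalIntegrable (fun s => v s (Y s)) volume 0 t) :
    ∀ s ∈ Icc 0 t, ‖X s - Y s‖ ≤
      (‖x - y‖ + ∫ r in (0 : ℝ)..t, ‖v r (Y r) - w r (Y r)‖) * Real.exp (K * s) := by
  rcases lt_or_ge t 0 with ht | ht
  · intro s hs; exact absurd (hs.1.trans hs.2) (not_le.2 ht)
  have hc : ContinuousOn (fun s => ‖X s - Y s‖) (Icc 0 t) :=
    (hX.continuousOn.sub hY.continuousOn).norm
  have hd := (hint.sub hY.intervalIntegrable).norm
  have hsub : ∀ s ∈ Icc 0 t, uIcc 0 s ⊆ uIcc 0 t := fun s hs => by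
    rw [uIcc_of_le hs.1, uIcc_of_le ht]; exact Icc_subset_Icc_right hs.2
  refine le_mul_exp_of_le_add_integral hc (fun _ _ => norm_nonneg _) ?_ hK ?_
  · exact add_nonneg (norm_nonneg _)
      (intervalIntegral.integral_nonneg ht fun _ _ => norm_nonneg _)
  intro s hs
  have iX := hX.intervalIntegrable.mono_set (hsub s hs)
  have iY := hY.intervalIntegrable.mono_set (hsub s hs)
  have iv := hint.mono_set (hsub s hs)
  have ic : IntervalIntegrable (fun s => ‖X s - Y s‖) volume 0 s :=
    (hc.mono (by rw [← uIcc_of_le ht]; exact hsub s hs)).intervalIntegrable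
  -- The first integral is handled by the Lipschitz bound; the second compares the two fields along
  -- the single trajectory `Y`.
  have e : X s - Y s = (x - y) + ((∫ r in (0 : ℝ)..s, (v r (X r) - v r (Y r))) +
      ∫ r in (0 : ℝ)..s, (v r (Y r) - w r (Y r))) := by
    rw [intervalIntegral.integral_sub iX iv, intervalIntegral.integral_sub iv iY,
      hX.eq_integral s hs, hY.eq_integral s hs]
    abel
  rw [e]
  have b1 : ‖∫ r in (0 : ℝ)..s, (v r (X r) - v r (Y r))‖ ≤
      K * ∫ r in (0 : ℝ)..s, ‖X r - Y r‖ := by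
    rw [← intervalIntegral.integral_const_mul]
    refine intervalIntegral.norm_integral_le_of_norm_le hs.1 (Eventually.of_forall fun r hr => ?_)
      (ic.const_mul K)
    exact hlip r ⟨hr.1.le, hr.2.trans hs.2⟩
  have b2 : ‖∫ r in (0 : ℝ)..s, (v r (Y r) - w r (Y r))‖ ≤
      ∫ r in (0 : ℝ)..t, ‖v r (Y r) - w r (Y r)‖ := by
    refine (intervalIntegral.norm_integral_le_integral_norm hs.1).trans ?_
    exact intervalIntegral.integral_mono_interval le_rfl hs.1 hs.2
      (Eventually.of_forall fun _ => norm_nonneg _) hd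
  calc _ ≤ ‖x - y‖ + (‖∫ r in (0 : ℝ)..s, (v r (X r) - v r (Y r))‖ +
        ‖∫ r in (0 : ℝ)..s, (v r (Y r) - w r (Y r))‖) :=
        (norm_add_le _ _).trans (by gcongr; exact norm_add_le _ _)
    _ ≤ _ := by linarith

theorem eqOn (hX : IsSolutionOn v x t X) (hY : IsSolutionOn v x t Y) {C K : ℝ → ℝ}
    (hv : LocallyControlled v C K) : ∀ s ∈ Icc 0 t, X s = Y s := by
  obtain ⟨R₁, h₁⟩ := isCompact_Icc.exists_bound_of_continuousOn hX.continuousOn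
  obtain ⟨R₂, h₂⟩ := isCompact_Icc.exists_bound_of_continuousOn hY.continuousOn
  intro s hs
  have := hX.norm_sub_le hY (hv.nonneg (max R₁ R₂)) (fun r hr => hv.lipschitz _ r _ _
    ((h₁ r hr).trans (le_max_left _ _)) ((h₂ r hr).trans (le_max_right _ _)))
    hY.intervalIntegrable s hs
  simpa [sub_eq_zero] using this

end IsSolutionOn

/-- Equality of predicates, rather than an equivalence, transfers to `flow`, which is defined by
choice. The half-open interval matters: at the end of a grid step the piecewise constant field has
already jumped. -/
theorem isSolutionOn_congr {v w : ℝ → Phase d → Phase d} {t : ℝ} (ht : 0 ≤ t)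
    (h : ∀ r ∈ Ico 0 t, v r = w r) (x : Phase d) : IsSolutionOn v x t = IsSolutionOn w x t := by
  ext X
  exact ⟨fun hX => hX.of_eqOn ht fun r hr => by rw [h r hr],
    fun hX => hX.of_eqOn ht fun r hr => by rw [h r hr]⟩

namespace LocallyControlled

variable {v : ℝ → Phase d → Phase d} {C K : ℝ}

/-- The Picard map on `C([0, t])` with the sup norm is a contraction with constant `K * t`. -/
theorem exists_isSolutionOn_of_mul_lt_one
    (hv : LocallyControlled v (fun _ => C) (fun _ => K)) {t : ℝ} (ht : 0 ≤ t) (hKt : K * t < 1)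
    (x : Phase d) : ∃ X, IsSolutionOn v x t X := by
  have hK : 0 ≤ K := hv.nonneg 0
  have hint : ∀ Y : C(Icc 0 t, Phase d),
      IntervalIntegrable (fun r => v r (IccExtend ht Y r)) volume 0 t := fun Y =>
    hv.intervalIntegrable (Y.continuous.Icc_extend' (h := ht)).continuousOn ht
  have hsub : ∀ s ∈ Icc 0 t, uIcc 0 s ⊆ uIcc 0 t := fun s hs => by
    rw [uIcc_of_le hs.1, uIcc_of_le ht]; exact Icc_subset_Icc_right hs.2
  have hcont : ∀ Y : C(Icc 0 t, Phase d), ContinuousOn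
      (fun s => x + ∫ r in (0 : ℝ)..s, v r (IccExtend ht Y r)) (Icc 0 t) := fun Y => by
    have := intervalIntegral.continuousOn_primitive_interval
      ((intervalIntegrable_iff' (by simp)).1 (hint Y))
    rw [uIcc_of_le ht] at this
    exact continuousOn_const.add this
  let F : C(Icc 0 t, Phase d) → C(Icc 0 t, Phase d) := fun Y =>
    ⟨(Icc 0 t).domRestrict fun s => x + ∫ r in (0 : ℝ)..s, v r (IccExtend ht Y r),
      (hcont Y).domRestrict⟩
  have hF : ContractingWith (Real.toNNReal (K * t)) F := by
    refine ⟨by simpa using hKt, LipschitzWith.of_dist_le_mul fun Y Z => ?_⟩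
    rw [Real.coe_toNNReal _ (mul_nonneg hK ht), ContinuousMap.dist_le (by positivity)]
    intro s
    have e : F Y s - F Z s = ∫ r in (0 : ℝ)..s,
        (v r (IccExtend ht Y r) - v r (IccExtend ht Z r)) := by
      rw [intervalIntegral.integral_sub ((hint Y).mono_set (hsub s s.2))
        ((hint Z).mono_set (hsub s s.2))]
      exact add_sub_add_left_eq_sub _ _ _
    rw [dist_eq_norm, e]
    refine (intervalIntegral.norm_integral_le_of_norm_le_const (C := K * dist Y Z)
      fun r _ => ?_).trans ?_
    · refine (hv.lipschitz (max ‖IccExtend ht Y r‖ ‖IccExtend ht Z r‖) r _ _ (le_max_left _ _)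
        (le_max_right _ _)).trans ?_
      refine mul_le_mul_of_nonneg_left ?_ hK
      rw [← dist_eq_norm]
      exact ContinuousMap.dist_apply_le_dist _
    · rw [sub_zero, abs_of_nonneg s.2.1, mul_right_comm]
      gcongr
      exact s.2.2
  have hfix := hF.fixedPoint_isFixedPt
  set Y := ContractingWith.fixedPoint F hF
  refine ⟨IccExtend ht Y, (Y.continuous.Icc_extend' (h := ht)).continuousOn, hint Y,
    fun s hs => ?_⟩
  rw [IccExtend_of_mem ht _ hs]
  exact (congrArg (fun Z : C(Icc 0 t, Phase d) => Z ⟨s, hs⟩) hfix).symm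

/-- Global existence for bounded, globally Lipschitz fields. -/
theorem exists_isSolutionOn (hv : LocallyControlled v (fun _ => C) (fun _ => K)) {t : ℝ}
    (ht : 0 ≤ t) (x : Phase d) : ∃ X, IsSolutionOn v x t X := by
  have hK : 0 ≤ K := hv.nonneg 0
  -- Short solutions on `m` steps of length `t / m` are glued; each step satisfies `K * (t / m) <
  -- 1`.
  obtain ⟨m, hm⟩ := exists_nat_gt (K * t)
  have hm0 : (0 : ℝ) < m := (mul_nonneg hK ht).trans_lt hm
  have key : ∀ j : ℕ, ∃ X, IsSolutionOn v x (j * (t / m)) X := by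
    intro j
    induction j with
    | zero =>
      refine hv.exists_isSolutionOn_of_mul_lt_one (by simp) (by simp) x
    | succ j ih =>
      obtain ⟨X, hX⟩ := ih
      obtain ⟨Y, hY⟩ := (hv.shift (j * (t / m))).exists_isSolutionOn_of_mul_lt_one
        (t := t / m) (by positivity) (by rwa [← mul_div_assoc, div_lt_one hm0]) (X (j * (t / m)))
      have := hX.concat hY (by positivity) (by positivity)
      rw [Nat.cast_succ, add_mul, one_mul]
      exact ⟨_, this⟩
  obtain ⟨X, hX⟩ := key m
  rw [mul_div_cancel₀ _ hm0.ne'] at hX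
  exact ⟨X, hX⟩

end LocallyControlled

end DeficientHamiltonian

/-! ### The flow and its stability under perturbation of field and initial point. -/

namespace DeficientHamiltonian

open Set

variable {d : ℕ} {v : ℝ → Phase d → Phase d} {C K : ℝ → ℝ} {t ε : ℝ} {x : Phase d}

theorem flow_eq (hv : LocallyControlled v C K) {X : ℝ → Phase d} (ht : 0 ≤ t)
    (hX : IsSolutionOn v x t X) : flow v t x = X t := by
  have h : ∃ X : ℝ → Phase d, IsSolutionOn v x t X := ⟨X, hX⟩
  rw [flow, dif_pos h]
  exact h.choose_spec.eqOn hX hv t ⟨ht, le_rfl⟩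

theorem flow_eqOn (hv : LocallyControlled v C K) {X : ℝ → Phase d}
    (hX : IsSolutionOn v x t X) : ∀ s ∈ Icc 0 t, flow v s x = X s := fun _ hs =>
  flow_eq hv hs.1 (hX.mono hs.1 hs.2)

theorem isSolutionOn_flow (hv : LocallyControlled v C K) (ht : 0 ≤ t) (hx : x ∈ survivors v t) :
    IsSolutionOn v x t (fun s => flow v s x) := by
  obtain ⟨X, hX⟩ := hx
  exact hX.congr ht (flow_eqOn hv hX)

theorem survivors_congr {w : ℝ → Phase d → Phase d} (ht : 0 ≤ t)
    (h : ∀ r ∈ Ico 0 t, v r = w r) : survivors v t = survivors w t := by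
  ext x
  rw [survivors, survivors, mem_ofPred_eq, mem_ofPred_eq, isSolutionOn_congr ht h x]

theorem flow_congr {w : ℝ → Phase d → Phase d} (ht : 0 ≤ t)
    (h : ∀ r ∈ Ico 0 t, v r = w r) : flow v t = flow w t := by
  ext x : 1
  rw [flow, flow, isSolutionOn_congr ht h x]

theorem weightAlongFlow_congr {w : ℝ → Phase d → Phase d} (ht : 0 ≤ t)
    (h : ∀ r ∈ Ico 0 t, v r = w r) : weightAlongFlow v ε t = weightAlongFlow w ε t := by
  ext x
  rw [weightAlongFlow, weightAlongFlow, intervalIntegral.integral_of_le ht,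
    intervalIntegral.integral_of_le ht, ← integral_Ico_eq_integral_Ioc,
    ← integral_Ico_eq_integral_Ioc]
  congr 2
  refine setIntegral_congr_fun measurableSet_Ico fun r hr => ?_
  simp only [h r hr, flow_congr hr.1 fun z hz => h z ⟨hz.1, hz.2.trans hr.2⟩]

theorem deficientTransport_congr {w : ℝ → Phase d → Phase d} (ht : 0 ≤ t)
    (h : ∀ r ∈ Ico 0 t, v r = w r) (ν : Measure (Phase d)) :
    deficientTransport v ε t ν = deficientTransport w ε t ν := by
  rw [deficientTransport, deficientTransport, survivors_congr ht h, flow_congr ht h,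
    weightAlongFlow_congr ht h]

section Stability

variable {ι : Type*} {l : Filter ι} [l.IsCountablyGenerated] {w : ι → ℝ → Phase d → Phase d}
  {y : ι → Phase d}

/-- The path stays in a ball, where all fields share a bound, so dominated convergence turns
pointwise convergence into convergence in mean along the path. The general filter `l` covers both
sequences and `𝓝 x`. -/
theorem tendsto_integral_norm_sub (hw : ∀ i, LocallyControlled (w i) C K)
    (hv : LocallyControlled v C K) (ht : 0 ≤ t)
    (h : ∀ s ∈ Icc 0 t, ∀ x, Tendsto (fun i => w i s x) l (𝓝 (v s x))) {X : ℝ → Phase d}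
    (hX : ContinuousOn X (Icc 0 t)) :
    Tendsto (fun i => ∫ r in (0 : ℝ)..t, ‖w i r (X r) - v r (X r)‖) l (𝓝 0) := by
  obtain ⟨R, hR⟩ := isCompact_Icc.exists_bound_of_continuousOn hX
  have := intervalIntegral.tendsto_integral_filter_of_dominated_convergence
    (μ := volume) (a := 0) (b := t) (l := l)
    (F := fun i r => ‖w i r (X r) - v r (X r)‖) (f := fun _ => (0 : ℝ)) (fun _ => C R + C R)
    (Eventually.of_forall fun i =>
      ((((hw i).intervalIntegrable hX ht).sub (hv.intervalIntegrable hX ht)).norm.def'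
        ).aestronglyMeasurable)
    (Eventually.of_forall fun i => Eventually.of_forall fun r hr => by
      rw [uIoc_of_le ht] at hr
      have hr' := hR r (Ioc_subset_Icc_self hr)
      rw [norm_norm]
      exact (norm_sub_le _ _).trans (add_le_add ((hw i).bound R r _ hr') (hv.bound R r _ hr')))
    intervalIntegrable_const
    (Eventually.of_forall fun r hr => by
      rw [uIoc_of_le ht] at hr
      exact tendsto_iff_norm_sub_tendsto_zero.1 (h r (Ioc_subset_Icc_self hr) (X r)))
  simpa using this

/-- Solutions depend continuously on the initial point and on the field; in particular they
persist under small perturbations. -/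
theorem eventually_mem_survivors_and_norm_sub_le (hw : ∀ i, LocallyControlled (w i) C K)
    (hv : LocallyControlled v C K) (ht : 0 ≤ t)
    (h : ∀ s ∈ Icc 0 t, ∀ x, Tendsto (fun i => w i s x) l (𝓝 (v s x)))
    (hy : Tendsto y l (𝓝 x)) (hx : x ∈ survivors v t) {η : ℝ} (hη : 0 < η) :
    ∀ᶠ i in l, y i ∈ survivors (w i) t ∧
      ∀ s ∈ Icc 0 t, ‖flow (w i) s (y i) - flow v s x‖ ≤ η := by
  have hX := isSolutionOn_flow hv ht hx
  set X := fun s => flow v s x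
  obtain ⟨R₀, hR₀⟩ := isCompact_Icc.exists_bound_of_continuousOn hX.continuousOn
  -- The margin `1` keeps every path within distance `1` of `X` inside the ball where truncation
  -- changes nothing.
  set R := |R₀| + 1
  have hR : 0 < R := by positivity
  have hXR : ∀ s ∈ Icc 0 t, ‖X s‖ + 1 ≤ R := fun s hs => by
    linarith [hR₀ s hs, le_abs_self R₀]
  have hXP : IsSolutionOn (fun s x => v s (radialRetraction R x)) x t X :=
    hX.of_eqOn ht fun r hr => by
      rw [radialRetraction_of_norm_le hR (by linarith [hXR r (Ico_subset_Icc_self hr)])]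
  have hwP := fun i => (hw i).comp_radialRetraction hR
  have hvP := hv.comp_radialRetraction hR
  choose Y hY using fun i => (hwP i).exists_isSolutionOn ht (y i)
  have hD := tendsto_integral_norm_sub hwP hvP ht (fun s hs x => h s hs _) hX.continuousOn
  have hB : Tendsto (fun i => (‖y i - x‖ + ∫ r in (0 : ℝ)..t,
      ‖w i r (radialRetraction R (X r)) - v r (radialRetraction R (X r))‖) *
        Real.exp (K R * 2 * t)) l (𝓝 0) := by
    have := ((tendsto_iff_norm_sub_tendsto_zero.1 hy).add hD).mul_const (Real.exp (K R * 2 * t))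
    simpa using this
  filter_upwards [hB.eventually_le_const (lt_min hη one_pos)] with i hi
  have hYX : ∀ s ∈ Icc 0 t, ‖Y i s - X s‖ ≤ min η 1 := fun s hs => by
    refine ((hY i).norm_sub_le hXP ((hwP i).nonneg 0) (fun r _ => (hwP i).lipschitz _ r _ _
      (le_max_left _ _) (le_max_right _ _))
      ((hwP i).intervalIntegrable hX.continuousOn ht) s hs).trans (le_trans ?_ hi)
    have := (hwP i).nonneg 0
    refine mul_le_mul_of_nonneg_left (Real.exp_le_exp.2 (mul_le_mul_of_nonneg_left hs.2 this)) ?_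
    exact add_nonneg (norm_nonneg _)
      (intervalIntegral.integral_nonneg ht fun _ _ => norm_nonneg _)
  have hYs : IsSolutionOn (w i) (y i) t (Y i) := (hY i).of_eqOn ht fun r hr => by
    have hr' := Ico_subset_Icc_self hr
    have h1 := norm_le_norm_add_norm_sub' (Y i r) (X r)
    rw [radialRetraction_of_norm_le hR]
    linarith [hXR r hr', (hYX r hr').trans (min_le_right _ _)]
  refine ⟨⟨_, hYs⟩, fun s hs => ?_⟩
  rw [flow_eqOn (hw i) hYs s hs]
  exact (hYX s hs).trans (min_le_left _ _)

/-- If the limiting trajectory explodes, then the approximating ones leave every ball. -/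
theorem eventually_exists_lt_norm_flow (hw : ∀ i, LocallyControlled (w i) C K)
    (hv : LocallyControlled v C K) (ht : 0 ≤ t)
    (h : ∀ s ∈ Icc 0 t, ∀ x, Tendsto (fun i => w i s x) l (𝓝 (v s x)))
    (hx : x ∉ survivors v t) (R₀ : ℝ) :
    ∀ᶠ i in l, x ∈ survivors (w i) t → ∃ s ∈ Icc 0 t, R₀ < ‖flow (w i) s x‖ := by
  set R := max R₀ 1
  have hR : 0 < R := lt_max_of_lt_right one_pos
  have hwP := fun i => (hw i).comp_radialRetraction hR
  have hvP := hv.comp_radialRetraction hR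
  obtain ⟨Y, hY⟩ := hvP.exists_isSolutionOn ht x
  -- A truncated solution that never left the ball would solve the original equation, and `x` would
  -- survive. An approximating trajectory confined to the ball would also solve its truncated
  -- equation, hence be close to `Y s₀`, which lies at positive distance outside.
  obtain ⟨s₀, hs₀, hYs₀⟩ : ∃ s ∈ Icc 0 t, R < ‖Y s‖ := by
    by_contra! hcon
    exact hx ⟨Y, hY.of_eqOn ht fun r hr => by
      rw [radialRetraction_of_norm_le hR (hcon r (Ico_subset_Icc_self hr))]⟩
  have hD := tendsto_integral_norm_sub hwP hvP ht (fun s hs x => h s hs _) hY.continuousOn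
  have hB := hD.mul_const (Real.exp (K R * 2 * s₀))
  rw [zero_mul] at hB
  filter_upwards [hB.eventually_lt_const (sub_pos.2 hYs₀)] with i hi hxi
  by_contra! hcon
  have hX := isSolutionOn_flow (hw i) ht hxi
  have hXP : IsSolutionOn (fun s x => w i s (radialRetraction R x)) x t
      (fun s => flow (w i) s x) :=
    hX.of_eqOn ht fun r hr => by
      rw [radialRetraction_of_norm_le hR
        ((hcon r (Ico_subset_Icc_self hr)).trans (le_max_left _ _))]
  have h1 := hXP.norm_sub_le hY ((hwP i).nonneg 0) (fun r _ => (hwP i).lipschitz _ r _ _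
      (le_max_left _ _) (le_max_right _ _)) ((hwP i).intervalIntegrable hY.continuousOn ht) s₀ hs₀
  rw [sub_self, norm_zero, zero_add] at h1
  have h2 := norm_le_norm_add_norm_sub (flow (w i) s₀ x) (Y s₀)
  have h3 := (hcon s₀ hs₀).trans (le_max_left R₀ 1)
  linarith

theorem tendsto_flow (hw : ∀ i, LocallyControlled (w i) C K)
    (hv : LocallyControlled v C K) (ht : 0 ≤ t)
    (h : ∀ s ∈ Icc 0 t, ∀ x, Tendsto (fun i => w i s x) l (𝓝 (v s x)))
    (hy : Tendsto y l (𝓝 x)) (hx : x ∈ survivors v t) :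
    ∀ s ∈ Icc 0 t, Tendsto (fun i => flow (w i) s (y i)) l (𝓝 (flow v s x)) := by
  intro s hs
  rw [Metric.tendsto_nhds]
  intro η hη
  filter_upwards [eventually_mem_survivors_and_norm_sub_le hw hv ht h hy hx (half_pos hη)]
    with i hi
  rw [dist_eq_norm]
  linarith [hi.2 s hs]

theorem tendsto_weightAlongFlow (hw : ∀ i, LocallyControlled (w i) C K)
    (hv : LocallyControlled v C K) (ht : 0 ≤ t)
    (h : ∀ s ∈ Icc 0 t, ∀ x, Tendsto (fun i => w i s x) l (𝓝 (v s x)))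
    (hy : Tendsto y l (𝓝 x)) (hx : x ∈ survivors v t) :
    Tendsto (fun i => weightAlongFlow (w i) ε t (y i)) l (𝓝 (weightAlongFlow v ε t x)) := by
  have hX := isSolutionOn_flow hv ht hx
  obtain ⟨R₀, hR₀⟩ := isCompact_Icc.exists_bound_of_continuousOn hX.continuousOn
  have hev := eventually_mem_survivors_and_norm_sub_le hw hv ht h hy hx one_pos
  have hball : ∀ᶠ i in l, ∀ s ∈ Icc 0 t, ‖flow (w i) s (y i)‖ ≤ R₀ + 1 := hev.mono fun i hi s hs => by
    have := norm_le_norm_add_norm_sub' (flow (w i) s (y i)) (flow v s x)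
    linarith [hi.2 s hs, hR₀ s hs]
  refine (Real.continuous_exp.tendsto _).comp (Tendsto.neg ?_)
  refine intervalIntegral.tendsto_integral_filter_of_dominated_convergence
    (fun _ => |ε| * C (R₀ + 1)) ?_ ?_ intervalIntegrable_const ?_
  · filter_upwards [hev] with i hi
    exact (((isSolutionOn_flow (hw i) ht hi.1).intervalIntegrable).norm.const_mul
      ε).def'.aestronglyMeasurable
  · filter_upwards [hball] with i hi
    refine Eventually.of_forall fun s hs => ?_
    rw [uIoc_of_le ht] at hs
    rw [norm_mul, norm_norm, Real.norm_eq_abs]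
    exact mul_le_mul_of_nonneg_left ((hw i).bound _ s _ (hi s (Ioc_subset_Icc_self hs)))
      (abs_nonneg ε)
  · refine Eventually.of_forall fun s hs => ?_
    rw [uIoc_of_le ht] at hs
    have hs' := Ioc_subset_Icc_self hs
    refine (Tendsto.norm ?_).const_mul ε
    have h1 := tendsto_flow hw hv ht h hy hx s hs'
    -- The Lipschitz bound common to all `w i` allows the moving point to be replaced by its limit;
    -- pointwise convergence of the fields does the rest.
    have h2 : Tendsto (fun i => w i s (flow (w i) s (y i)) - w i s (flow v s x)) l (𝓝 0) := by
      refine squeeze_zero_norm' (a := fun i => K (R₀ + 1) * ‖flow (w i) s (y i) - flow v s x‖)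
        ?_ ?_
      · filter_upwards [hball] with i hi
        exact (hw i).lipschitz _ s _ _ (hi s hs') ((hR₀ s hs').trans (by linarith))
      · simpa using (tendsto_iff_norm_sub_tendsto_zero.1 h1).const_mul (K (R₀ + 1))
    simpa using h2.add (h s hs' (flow v s x))

end Stability

/-- This is persistence of solutions for the constant family `w i = v`, along the filter `𝓝 x` of
initial points. -/
theorem isOpen_survivors (hv : LocallyControlled v C K) (ht : 0 ≤ t) :
    IsOpen (survivors v t) := by
  rw [isOpen_iff_mem_nhds]
  intro x hx
  exact (eventually_mem_survivors_and_norm_sub_le (l := 𝓝 x) (w := fun _ => v) (y := id)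
    (fun _ => hv) hv ht (fun _ _ _ => tendsto_const_nhds) tendsto_id hx one_pos).mono
      fun _ h => h.1

theorem continuousOn_flow (hv : LocallyControlled v C K) (ht : 0 ≤ t) :
    ContinuousOn (flow v t) (survivors v t) := fun x hx =>
  (tendsto_flow (l := 𝓝 x) (w := fun _ => v) (y := id) (fun _ => hv) hv ht
    (fun _ _ _ => tendsto_const_nhds) tendsto_id hx t ⟨ht, le_rfl⟩).mono_left nhdsWithin_le_nhds

theorem continuousOn_weightAlongFlow (hv : LocallyControlled v C K) (ht : 0 ≤ t) :
    ContinuousOn (weightAlongFlow v ε t) (survivors v t) := fun x hx =>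
  (tendsto_weightAlongFlow (l := 𝓝 x) (w := fun _ => v) (y := id) (fun _ => hv) hv ht
    (fun _ _ _ => tendsto_const_nhds) tendsto_id hx).mono_left nhdsWithin_le_nhds

end DeficientHamiltonian

/-! ### Deficient transport: duality, mass, moments and the semigroup property. -/

namespace DeficientHamiltonian

open Set

variable {d : ℕ} {v : ℝ → Phase d → Phase d} {C K : ℝ → ℝ} {t τ ε : ℝ} {x : Phase d}

theorem weightAlongFlow_le_one (hε : 0 ≤ ε) (ht : 0 ≤ t) (v : ℝ → Phase d → Phase d)
    (x : Phase d) : weightAlongFlow v ε t x ≤ 1 := by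
  rw [weightAlongFlow, Real.exp_le_one_iff, neg_nonpos]
  exact intervalIntegral.integral_nonneg ht fun _ _ => by positivity

theorem weightAlongFlow_nonneg (v : ℝ → Phase d → Phase d) (ε t : ℝ) (x : Phase d) :
    0 ≤ weightAlongFlow v ε t x := (Real.exp_pos _).le

theorem weightAlongFlow_eq (hv : LocallyControlled v C K) {X : ℝ → Phase d} (ht : 0 ≤ t)
    (hX : IsSolutionOn v x t X) :
    weightAlongFlow v ε t x = Real.exp (-(ε * ∫ s in (0 : ℝ)..t, ‖v s (X s)‖)) := by
  rw [weightAlongFlow, ← intervalIntegral.integral_const_mul]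
  congr 2
  refine intervalIntegral.integral_congr fun s hs => ?_
  rw [uIcc_of_le ht] at hs
  simp only [flow_eqOn hv hX s hs]

/-- The displacement along a trajectory is bounded by its length. -/
theorem IsSolutionOn.norm_sub_le_integral_norm {X : ℝ → Phase d} (hX : IsSolutionOn v x t X)
    {s : ℝ} (hs : s ∈ Icc 0 t) : ‖X s - x‖ ≤ ∫ r in (0 : ℝ)..t, ‖v r (X r)‖ := by
  rw [hX.eq_integral s hs, add_sub_cancel_left]
  refine (intervalIntegral.norm_integral_le_integral_norm hs.1).trans ?_
  exact intervalIntegral.integral_mono_interval le_rfl hs.1 hs.2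
    (Eventually.of_forall fun _ => norm_nonneg _) hX.intervalIntegrable.norm

theorem measurable_flow (hv : LocallyControlled v C K) (ht : 0 ≤ t) : Measurable (flow v t) := by
  classical
  have : flow v t = (survivors v t).piecewise (flow v t) id := by
    ext x : 1
    by_cases hx : x ∈ survivors v t
    · rw [piecewise_eq_of_mem _ _ _ hx]
    · rw [piecewise_eq_of_notMem _ _ _ hx]
      exact dif_neg hx
  rw [this]
  exact (continuousOn_flow hv ht).measurable_piecewise continuousOn_id
    (isOpen_survivors hv ht).measurableSet

theorem aemeasurable_weightAlongFlow (hv : LocallyControlled v C K) (ht : 0 ≤ t)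
    (ν : Measure (Phase d)) :
    AEMeasurable (weightAlongFlow v ε t) (ν.restrict (survivors v t)) :=
  (continuousOn_weightAlongFlow hv ht).aemeasurable (isOpen_survivors hv ht).measurableSet

theorem lintegral_deficientTransport (hv : LocallyControlled v C K) (ht : 0 ≤ t)
    (ν : Measure (Phase d)) {ψ : Phase d → ENNReal} (hψ : Measurable ψ) :
    ∫⁻ y, ψ y ∂(deficientTransport v ε t ν) =
      ∫⁻ x in survivors v t, ENNReal.ofReal (weightAlongFlow v ε t x) * ψ (flow v t x) ∂ν := by
  rw [deficientTransport, lintegral_map hψ (measurable_flow hv ht),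
    lintegral_withDensity_eq_lintegral_mul₀
      (aemeasurable_weightAlongFlow hv ht ν).ennreal_ofReal
      (g := fun x => ψ (flow v t x)) (hψ.comp (measurable_flow hv ht)).aemeasurable]
  rfl

theorem integral_deficientTransport (hv : LocallyControlled v C K) (ht : 0 ≤ t)
    (ν : Measure (Phase d)) {ψ : Phase d → ℝ} (hψ : Continuous ψ) :
    ∫ y, ψ y ∂(deficientTransport v ε t ν) =
      ∫ x in survivors v t, ψ (flow v t x) * weightAlongFlow v ε t x ∂ν := by
  rw [deficientTransport, integral_map (measurable_flow hv ht).aemeasurable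
      hψ.aestronglyMeasurable,
    integral_withDensity_eq_integral_toReal_smul₀
      (aemeasurable_weightAlongFlow hv ht ν).ennreal_ofReal
      (Eventually.of_forall fun _ => ENNReal.ofReal_lt_top)]
  refine integral_congr_ae (Eventually.of_forall fun x => ?_)
  simp only [smul_eq_mul, ENNReal.toReal_ofReal (weightAlongFlow_nonneg v ε t x)]
  exact mul_comm _ _

/-- Nothing is required of `v`, since a non-measurable map pushes every measure to `0`. Hence the
grid measures are known to be finite before their fields are known to be controlled, which itself
depends on finite mass. -/
theorem deficientTransport_univ_le (hε : 0 ≤ ε) (ht : 0 ≤ t) (v : ℝ → Phase d → Phase d)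
    (ν : Measure (Phase d)) : deficientTransport v ε t ν univ ≤ ν univ := by
  by_cases hm : AEMeasurable (flow v t) ((ν.restrict (survivors v t)).withDensity
      (fun x => ENNReal.ofReal (weightAlongFlow v ε t x)))
  · rw [deficientTransport, Measure.map_apply_of_aemeasurable hm .univ, preimage_univ,
      withDensity_apply _ .univ, Measure.restrict_univ]
    calc _ ≤ ∫⁻ _ in survivors v t, 1 ∂ν := lintegral_mono fun x => by
          simpa using weightAlongFlow_le_one hε ht v x
      _ ≤ ν univ := by simpa using measure_mono (subset_univ _)
  · rw [deficientTransport, Measure.map_of_not_aemeasurable hm]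
    simp

/-- The decay of mass controls exponential moments. -/
theorem expMoment_deficientTransport_le (hv : LocallyControlled v C K) (ht : 0 ≤ t) {α : ℝ}
    (hα : 0 ≤ α) (hαε : α ≤ ε) (ν : Measure (Phase d)) :
    expMoment α (deficientTransport v ε t ν) ≤ expMoment α ν := by
  rw [expMoment, lintegral_deficientTransport hv ht ν (by fun_prop), expMoment]
  refine le_trans (setLIntegral_mono' (isOpen_survivors hv ht).measurableSet fun x hx => ?_)
    (setLIntegral_le_lintegral _ _)
  have hX := isSolutionOn_flow hv ht hx
  rw [weightAlongFlow_eq hv ht hX, ← ENNReal.ofReal_mul (Real.exp_pos _).le, ← Real.exp_add]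
  refine ENNReal.ofReal_le_ofReal (Real.exp_le_exp.2 ?_)
  -- With `ℓ` the length of the trajectory, `α‖X t‖ - ε ℓ ≤ α‖x‖ + (α - ε) ℓ ≤ α‖x‖`.
  have h1 := hX.norm_sub_le_integral_norm (s := t) ⟨ht, le_rfl⟩
  have h2 := norm_le_norm_add_norm_sub' (flow v t x) x
  have h3 : 0 ≤ ∫ r in (0 : ℝ)..t, ‖v r (flow v r x)‖ :=
    intervalIntegral.integral_nonneg ht fun _ _ => norm_nonneg _
  have h4 := mul_le_mul_of_nonneg_right hαε h3
  have h5 := mul_le_mul_of_nonneg_left (h2.trans (add_le_add_right h1 _)) hα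
  linarith

theorem mem_survivors_add_iff (hv : LocallyControlled v C K) (hτ : 0 ≤ τ) (ht : 0 ≤ t) :
    x ∈ survivors v (τ + t) ↔
      x ∈ survivors v τ ∧ flow v τ x ∈ survivors (fun s => v (τ + s)) t := by
  constructor
  · rintro ⟨X, hX⟩
    have h1 := hX.mono hτ (by linarith)
    refine ⟨⟨X, h1⟩, fun s => X (τ + s), ?_⟩
    rw [flow_eq hv hτ h1]
    exact hX.shift hτ ht
  · rintro ⟨⟨X, hX⟩, Y, hY⟩
    rw [flow_eq hv hτ hX] at hY
    exact ⟨_, hX.concat hY hτ ht⟩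

theorem flow_add (hv : LocallyControlled v C K) (hτ : 0 ≤ τ) (ht : 0 ≤ t)
    (hx : x ∈ survivors v (τ + t)) :
    flow v (τ + t) x = flow (fun s => v (τ + s)) t (flow v τ x) :=
  (flow_eq (hv.shift τ) ht ((isSolutionOn_flow hv (add_nonneg hτ ht) hx).shift hτ ht)).symm

theorem weightAlongFlow_add (hv : LocallyControlled v C K) (hτ : 0 ≤ τ) (ht : 0 ≤ t)
    (hx : x ∈ survivors v (τ + t)) :
    weightAlongFlow v ε (τ + t) x =
      weightAlongFlow v ε τ x * weightAlongFlow (fun s => v (τ + s)) ε t (flow v τ x) := by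
  have hX := isSolutionOn_flow hv (add_nonneg hτ ht) hx
  have hX1 := hX.mono hτ (by linarith)
  rw [weightAlongFlow_eq hv (add_nonneg hτ ht) hX, weightAlongFlow_eq hv hτ hX1,
    weightAlongFlow_eq (hv.shift τ) ht (hX.shift hτ ht), ← Real.exp_add, ← neg_add, ← mul_add]
  have h2 := intervalIntegral.integral_comp_add_left (a := 0) (b := t)
      (fun r => ‖v r (flow v r x)‖) τ
  rw [h2, add_zero, intervalIntegral.integral_add_adjacent_intervals hX1.intervalIntegrable.norm
    (hX.intervalIntegrable_of_mem ⟨hτ, by linarith⟩ ⟨by linarith, le_rfl⟩).norm]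

/-- The semigroup property of deficient transport. -/
theorem deficientTransport_deficientTransport (hv : LocallyControlled v C K) (hτ : 0 ≤ τ)
    (ht : 0 ≤ t) (ν : Measure (Phase d)) :
    deficientTransport (fun s => v (τ + s)) ε t (deficientTransport v ε τ ν) =
      deficientTransport v ε (τ + t) ν := by
  classical
  refine Measure.ext_of_lintegral _ fun ψ hψ => ?_
  set w : ℝ → Phase d → Phase d := fun s => v (τ + s) with hw
  have hwc : LocallyControlled w C K := hv.shift τ
  -- Extending the second weight by `0` gives a globally measurable function, to which duality for
  -- the first transport applies.
  set g : Phase d → ENNReal := (survivors w t).piecewise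
    (fun y => ENNReal.ofReal (weightAlongFlow w ε t y)) 0 with hg
  have hgm : Measurable g :=
    (ENNReal.continuous_ofReal.comp_continuousOn (continuousOn_weightAlongFlow hwc ht)
      ).measurable_piecewise continuousOn_const (isOpen_survivors hwc ht).measurableSet
  have hS := (isOpen_survivors hwc ht).measurableSet
  have hτt := add_nonneg hτ ht
  rw [lintegral_deficientTransport hwc ht _ hψ, lintegral_deficientTransport hv hτt _ hψ]
  have e1 : ∫⁻ y in survivors w t, ENNReal.ofReal (weightAlongFlow w ε t y) * ψ (flow w t y)
      ∂(deficientTransport v ε τ ν) =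
      ∫⁻ y, g y * ψ (flow w t y) ∂(deficientTransport v ε τ ν) := by
    rw [← lintegral_indicator hS]
    refine lintegral_congr fun y => ?_
    by_cases hy : y ∈ survivors w t <;> simp [hg, hy]
  rw [e1, lintegral_deficientTransport hv hτ _ (ψ := fun y => g y * ψ (flow w t y))
      (hgm.mul (hψ.comp (measurable_flow hwc ht))),
    ← lintegral_indicator (isOpen_survivors hv hτ).measurableSet,
    ← lintegral_indicator (isOpen_survivors hv hτt).measurableSet]
  refine lintegral_congr fun x => ?_
  have hiff := mem_survivors_add_iff (x := x) hv hτ ht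
  by_cases hx : x ∈ survivors v (τ + t)
  · have hx1 := (hiff.1 hx).1
    have hx2 := (hiff.1 hx).2
    rw [indicator_of_mem hx, indicator_of_mem hx1, flow_add hv hτ ht hx,
      weightAlongFlow_add hv hτ ht hx, ENNReal.ofReal_mul (weightAlongFlow_nonneg _ _ _ _),
      hg, piecewise_eq_of_mem _ _ _ hx2, mul_assoc]
  · rw [indicator_of_notMem hx]
    by_cases hx1 : x ∈ survivors v τ
    · have hx2 : flow v τ x ∉ survivors w t := fun h => hx (hiff.2 ⟨hx1, h⟩)
      rw [indicator_of_mem hx1, hg, piecewise_eq_of_notMem _ _ _ hx2]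
      simp
    · rw [indicator_of_notMem hx1]

end DeficientHamiltonian

/-! ### Short-time estimates for deficient transport. -/

namespace DeficientHamiltonian

open Set

variable {d : ℕ} {v : ℝ → Phase d → Phase d} {C K : ℝ → ℝ} {t ε : ℝ} {x : Phase d}

theorem integrableOn_comp_flow_mul_weight (hv : LocallyControlled v C K) (ht : 0 ≤ t)
    (hε : 0 ≤ ε) (ν : Measure (Phase d)) [IsFiniteMeasure ν] {φ : Phase d → ℝ}
    (hφ : Continuous φ) {B : ℝ} (hB : ∀ x, ‖φ x‖ ≤ B) :
    IntegrableOn (fun x => φ (flow v t x) * weightAlongFlow v ε t x) (survivors v t) ν := by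
  refine IntegrableOn.of_bound (measure_lt_top _ _) ?_ B (Eventually.of_forall fun x => ?_)
  · exact ((hφ.measurable.comp (measurable_flow hv ht)).aemeasurable.mul
      (aemeasurable_weightAlongFlow hv ht ν)).aestronglyMeasurable
  · rw [norm_mul, Real.norm_of_nonneg (weightAlongFlow_nonneg _ _ _ _)]
    exact (mul_le_of_le_one_right (norm_nonneg _) (weightAlongFlow_le_one hε ht v x)).trans (hB _)

/-- The truncated trajectory has speed at most `C R`, so it cannot leave the ball by time `t` and
truncation is invisible. -/
theorem mem_survivors_of_norm_le (hv : LocallyControlled v C K) (ht : 0 ≤ t) {R : ℝ} (hR : 0 < R)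
    (hx : ‖x‖ + C R * t ≤ R) :
    x ∈ survivors v t ∧ ∫ s in (0 : ℝ)..t, ‖v s (flow v s x)‖ ≤ C R * t := by
  have hvP := hv.comp_radialRetraction hR
  have hC : 0 ≤ C R := (norm_nonneg _).trans (hv.bound R 0 0 (by simpa using hR.le))
  obtain ⟨Y, hY⟩ := hvP.exists_isSolutionOn ht x
  have hlen : ∫ s in (0 : ℝ)..t, ‖v s (radialRetraction R (Y s))‖ ≤ C R * t := by
    have h := intervalIntegral.integral_mono_on ht hY.intervalIntegrable.norm
      (intervalIntegrable_const (μ := volume) (c := C R)) fun s _ => hvP.bound ‖Y s‖ s (Y s) le_rfl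
    simpa [mul_comm] using h
  have hYR : ∀ s ∈ Icc 0 t, ‖Y s‖ ≤ R := fun s hs => by
    have := (hY.norm_sub_le_integral_norm hs).trans hlen
    linarith [norm_le_norm_add_norm_sub' (Y s) x]
  have hYv : IsSolutionOn v x t Y := hY.of_eqOn ht fun s hs => by
    rw [radialRetraction_of_norm_le hR (hYR s (Ico_subset_Icc_self hs))]
  refine ⟨⟨Y, hYv⟩, le_trans (le_of_eq ?_) hlen⟩
  refine intervalIntegral.integral_congr fun s hs => ?_
  rw [uIcc_of_le ht] at hs
  simp only [flow_eqOn hv hYv s hs, radialRetraction_of_norm_le hR (hYR s hs)]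

/-- A trajectory needs a definite time to cross an annulus. -/
theorem lt_norm_of_isSolutionOn {X : ℝ → Phase d} (hX : IsSolutionOn v x t X) (ht : 0 ≤ t)
    {r c : ℝ} (hc : 0 ≤ c) (hv : ∀ s y, ‖y‖ ≤ r + 1 → ‖v s y‖ ≤ c) (hct : c * t < 1)
    (hx : r + 1 ≤ ‖x‖) : r < ‖X t‖ := by
  have hcl : IsCompact (Icc 0 t ∩ {s | r + 1 ≤ ‖X s‖}) := by
    refine isCompact_Icc.of_isClosed_subset ?_ inter_subset_left
    exact hX.continuousOn.norm.preimage_isClosed_of_isClosed isClosed_Icc isClosed_Ici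
  have hne : (Icc 0 t ∩ {s | r + 1 ≤ ‖X s‖}).Nonempty :=
    ⟨0, ⟨le_rfl, ht⟩, by simpa [hX.apply_zero ht] using hx⟩
  -- After the last time at norm at least `r + 1` the speed is at most `c`, so less than one unit is
  -- travelled.
  obtain ⟨s₀, ⟨hs₀, hXs₀⟩, hmax⟩ := hcl.exists_isGreatest hne
  have hdiff : ‖X t - X s₀‖ ≤ c * (t - s₀) := by
    rw [hX.sub_eq_integral hs₀ ⟨ht, le_rfl⟩, ← abs_of_nonneg (sub_nonneg.2 hs₀.2)]
    refine intervalIntegral.norm_integral_le_of_norm_le_const fun s hs => hv s _ ?_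
    rw [uIoc_of_le hs₀.2] at hs
    by_contra! hcon
    exact absurd (hmax ⟨⟨hs₀.1.trans hs.1.le, hs.2⟩, hcon.le⟩) (not_le.2 hs.1)
  have h1 : c * (t - s₀) ≤ c * t := mul_le_mul_of_nonneg_left (by linarith [hs₀.1]) hc
  have h2 := norm_le_norm_add_norm_sub (X t) (X s₀)
  have h3 : r + 1 ≤ ‖X s₀‖ := hXs₀
  linarith

/-- Deficient transport over a short time changes integrals of test functions by little. -/
theorem norm_integral_deficientTransport_sub_le (hv : LocallyControlled v C K) (ht : 0 ≤ t)
    (hε : 0 ≤ ε) (ν : Measure (Phase d)) [IsFiniteMeasure ν] {φ : Phase d → ℝ} {B r : ℝ}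
    {L : NNReal} (hL : LipschitzWith L φ) (hB : ∀ x, ‖φ x‖ ≤ B) (hr : 0 ≤ r)
    (hφ0 : ∀ x, r < ‖x‖ → φ x = 0) (hct : C (r + 2) * t < 1) :
    ‖∫ y, φ y ∂(deficientTransport v ε t ν) - ∫ y, φ y ∂ν‖ ≤
      (L + B * ε) * (C (r + 2) * t) * ν.real univ := by
  have hS := (isOpen_survivors hv ht).measurableSet
  have hI := integrableOn_comp_flow_mul_weight (ε := ε) hv ht hε ν hL.continuous hB
  have hφi : Integrable φ ν :=
    Integrable.of_bound hL.continuous.aestronglyMeasurable B (Eventually.of_forall hB)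
  have hc : 0 ≤ C (r + 2) :=
    (norm_nonneg _).trans (hv.bound (r + 2) 0 0 (by simpa using by linarith))
  have hB0 : 0 ≤ B := (norm_nonneg _).trans (hB 0)
  rw [integral_deficientTransport hv ht ν hL.continuous, ← integral_indicator hS,
    ← integral_sub (hI.integrable_indicator hS) hφi]
  refine norm_integral_le_of_norm_le_const (Eventually.of_forall fun x => ?_)
  have hpos : 0 ≤ (L + B * ε) * (C (r + 2) * t) := by positivity
  -- Points within `r + 1` travel less than `1`, so they survive inside the ball of radius `r + 2`.
  -- Points farther out cannot enter the support of `φ` by time `t`, so they contribute nothing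
  -- whether or not they survive.
  rcases le_or_gt ‖x‖ (r + 1) with hx | hx
  · obtain ⟨hxS, hlen⟩ := mem_survivors_of_norm_le hv ht (R := r + 2) (by linarith) (x := x)
      (by linarith)
    rw [indicator_of_mem hxS]
    have hX := isSolutionOn_flow hv ht hxS
    have h1 : ‖φ (flow v t x) - φ x‖ ≤ L * (C (r + 2) * t) :=
      (hL.norm_sub_le _ _).trans (mul_le_mul_of_nonneg_left
        ((hX.norm_sub_le_integral_norm (s := t) ⟨ht, le_rfl⟩).trans hlen) L.2)
    have h2 : 1 - weightAlongFlow v ε t x ≤ ε * (C (r + 2) * t) := by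
      rw [weightAlongFlow_eq hv ht hX]
      have := Real.add_one_le_exp (-(ε * ∫ s in (0 : ℝ)..t, ‖v s (flow v s x)‖))
      have := mul_le_mul_of_nonneg_left hlen hε
      linarith
    have h3 := weightAlongFlow_le_one hε ht v x
    have e : φ (flow v t x) * weightAlongFlow v ε t x - φ x =
        (φ (flow v t x) - φ x) - φ (flow v t x) * (1 - weightAlongFlow v ε t x) := by ring
    rw [e]
    refine (norm_sub_le _ _).trans ?_
    rw [norm_mul, Real.norm_of_nonneg (sub_nonneg.2 h3)]
    have h4 := mul_le_mul (hB (flow v t x)) h2 (sub_nonneg.2 h3) hB0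
    linarith
  · rw [hφ0 x (by linarith), sub_zero]
    by_cases hxS : x ∈ survivors v t
    · have := lt_norm_of_isSolutionOn (isSolutionOn_flow hv ht hxS) ht hc
        (fun s y hy => hv.bound (r + 2) s y (by linarith)) hct hx.le
      rw [indicator_of_mem hxS, hφ0 _ this]
      simpa using hpos
    · rw [indicator_of_notMem hxS]
      simpa using hpos

end DeficientHamiltonian

/-! ### Tightness and the passage from test functions to bounded continuous functions. -/

namespace DeficientHamiltonian

open Set

variable {d : ℕ}

/-- Bounded continuous functions are approximated, away from infinity, by test functions. -/
theorem exists_contDiff_hasCompactSupport_approx {g : Phase d → ℝ} (hg : Continuous g) {B : ℝ}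
    (hB : ∀ x, ‖g x‖ ≤ B) (R : ℝ) {η : ℝ} (hη : 0 < η) :
    ∃ φ : Phase d → ℝ, ContDiff ℝ ∞ φ ∧ HasCompactSupport φ ∧
      ∀ x, ‖g x - φ x‖ ≤ η + {x | R < ‖x‖}.indicator (fun _ => B) x := by
  -- `χ` is `1` on the ball of radius `R` and `0` beyond `R + 1`. The smooth approximation of `g *
  -- χ` keeps its support inside that of `g * χ`.
  set χ : Phase d → ℝ := fun x => max 0 (min 1 (R + 1 - ‖x‖))
  have hχ : Continuous χ := by fun_prop
  have hχ0 : ∀ x, 0 ≤ χ x := fun x => le_max_left _ _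
  have hχ1 : ∀ x, χ x ≤ 1 := fun x => max_le zero_le_one (min_le_left _ _)
  obtain ⟨φ, hφ, hφg, hsupp⟩ := (hg.mul hχ).exists_contDiff_approx (ε := fun _ => η) ⊤
    continuous_const fun _ => hη
  refine ⟨φ, hφ, ?_, fun x => ?_⟩
  · refine HasCompactSupport.intro (isCompact_closedBall 0 (R + 1)) fun x hx => ?_
    by_contra hne
    refine hsupp (Function.mem_support.2 hne) ?_
    have hx' : R + 1 < ‖x‖ := by simpa using hx
    have : χ x = 0 := max_eq_left ((min_le_right _ _).trans (by linarith))
    simp [this]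
  · have h1 : ‖g x * χ x - φ x‖ ≤ η := by
      rw [← dist_eq_norm, dist_comm]; exact (hφg x).le
    have h2 : ‖g x - g x * χ x‖ ≤ {x | R < ‖x‖}.indicator (fun _ => B) x := by
      by_cases hx : R < ‖x‖
      · rw [indicator_of_mem (show x ∈ {x | R < ‖x‖} from hx)]
        have e : g x - g x * χ x = g x * (1 - χ x) := by ring
        rw [e, norm_mul, Real.norm_of_nonneg (sub_nonneg.2 (hχ1 x))]
        exact (mul_le_of_le_one_right (norm_nonneg _) (by linarith [hχ0 x])).trans (hB x)
      · rw [indicator_of_notMem (show x ∉ {x | R < ‖x‖} from hx)]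
        have : χ x = 1 := by
          have : min 1 (R + 1 - ‖x‖) = 1 := min_eq_left (by linarith [not_lt.1 hx])
          simp [χ, this]
        simp [this]
    calc ‖g x - φ x‖ = ‖(g x * χ x - φ x) + (g x - g x * χ x)‖ := by congr 1; ring
      _ ≤ _ := (norm_add_le _ _).trans (add_le_add h1 h2)

theorem exists_measureReal_norm_gt_le (ν : Measure (Phase d)) [IsFiniteMeasure ν] {η : ℝ}
    (hη : 0 < η) : ∃ R, ∀ R' ≥ R, ν.real {x | R' < ‖x‖} ≤ η := by
  have h := tendsto_measure_norm_gt_of_isTightMeasureSet (isTightMeasureSet_singleton (μ := ν))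
  simp only [mem_singleton_iff, iSup_iSup_eq_left] at h
  obtain ⟨R, hR⟩ := eventually_atTop.1 (h.eventually_le_const (ENNReal.ofReal_pos.2 hη))
  exact ⟨R, fun R' hR' => ENNReal.toReal_le_of_le_ofReal hη.le (hR R' hR')⟩

/-- Markov's inequality for `exp (α‖x‖)`; the tail bound depends on `ν` only through its moment,
hence is uniform. -/
theorem measureReal_norm_gt_le (ν : Measure (Phase d)) {α R : ℝ} {m : ℝ}
    (hα : 0 ≤ α) (hm : 0 ≤ m) (h : expMoment α ν ≤ ENNReal.ofReal m) :
    ν.real {x | R < ‖x‖} ≤ Real.exp (-(α * R)) * m := by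
  have h1 := (mul_meas_ge_le_lintegral (μ := ν)
    (f := fun x => ENNReal.ofReal (Real.exp (α * ‖x‖))) (by fun_prop)
    (ENNReal.ofReal (Real.exp (α * R)))).trans h
  have h2 : ν {x | R < ‖x‖} ≤ ν {x | ENNReal.ofReal (Real.exp (α * R)) ≤
      ENNReal.ofReal (Real.exp (α * ‖x‖))} := measure_mono fun x hx =>
    ENNReal.ofReal_le_ofReal (Real.exp_le_exp.2 (mul_le_mul_of_nonneg_left (le_of_lt hx) hα))
  refine ENNReal.toReal_le_of_le_ofReal (by positivity) (h2.trans ?_)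
  rw [Real.exp_neg, ENNReal.ofReal_mul (by positivity), ENNReal.ofReal_inv_of_pos (Real.exp_pos _),
    mul_comm _ (ENNReal.ofReal m), ← div_eq_mul_inv,
    ENNReal.le_div_iff_mul_le (by simp [Real.exp_pos]) (by simp), mul_comm]
  exact h1

/-- For uniformly tight sequences of measures, convergence in the sense of distributions implies
convergence against bounded continuous functions. -/
theorem DistribTendsto.tendsto_integral {ν : ℕ → Measure (Phase d)} {ν' : Measure (Phase d)}
    [∀ k, IsFiniteMeasure (ν k)] [IsFiniteMeasure ν'] (h : DistribTendsto ν ν') {M : ℝ}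
    (hM : ∀ k, (ν k).real univ ≤ M)
    (htail : ∀ η > 0, ∃ R, ∀ R' ≥ R, ∀ k, (ν k).real {x | R' < ‖x‖} ≤ η)
    {g : Phase d → ℝ} (hg : Continuous g) {B : ℝ} (hB : ∀ x, ‖g x‖ ≤ B) :
    Tendsto (fun k => ∫ x, g x ∂(ν k)) atTop (𝓝 (∫ x, g x ∂ν')) := by
  have hB0 : 0 ≤ B := (norm_nonneg _).trans (hB 0)
  have hM0 : 0 ≤ M := measureReal_nonneg.trans (hM 0)
  rw [Metric.tendsto_atTop]
  intro e he
  set M' := max M (ν'.real univ)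
  -- Each of the three distances in the final chain is then at most `e / 4`, and the `+ 1` keeps the
  -- denominator positive.
  set η := e / (4 * (M' + B + 1)) with hηdef
  have hMM : 0 ≤ M' := hM0.trans (le_max_left _ _)
  have hη : 0 < η := by positivity
  have hηe : η * M' + B * η ≤ e / 4 := by
    have : η * (M' + B + 1) = e / 4 := by rw [hηdef]; field_simp
    nlinarith
  obtain ⟨R₁, hR₁⟩ := htail η hη
  obtain ⟨R₂, hR₂⟩ := exists_measureReal_norm_gt_le ν' hη
  set R := max R₁ R₂
  obtain ⟨φ, hφ, hφc, hgφ⟩ := exists_contDiff_hasCompactSupport_approx hg hB R hη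
  have key : ∀ (m : Measure (Phase d)) [IsFiniteMeasure m], m.real univ ≤ M' →
      m.real {x | R < ‖x‖} ≤ η → ‖∫ x, g x ∂m - ∫ x, φ x ∂m‖ ≤ e / 4 := by
    intro m _ hm1 hm2
    have hms : MeasurableSet {x : Phase d | R < ‖x‖} :=
      (isOpen_lt continuous_const continuous_norm).measurableSet
    have hgi : Integrable g m :=
      Integrable.of_bound hg.aestronglyMeasurable B (Eventually.of_forall hB)
    have hφi : Integrable φ m := hφ.continuous.integrable_of_hasCompactSupport hφc
    rw [← integral_sub hgi hφi]
    refine (norm_integral_le_of_norm_le ((integrable_const η).add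
      ((integrable_const B).indicator hms)) (Eventually.of_forall hgφ)).trans ?_
    rw [integral_add' (integrable_const η) ((integrable_const B).indicator hms),
      integral_indicator hms, integral_const, setIntegral_const, smul_eq_mul, smul_eq_mul]
    have h1 := mul_le_mul_of_nonneg_left hm1 hη.le
    have h2 := mul_le_mul_of_nonneg_left hm2 hB0
    linarith
  obtain ⟨N, hN⟩ := Metric.tendsto_atTop.1 (h φ hφ hφc) (e / 4) (by positivity)
  refine ⟨N, fun k hk => ?_⟩
  have h1 := key (ν k) ((hM k).trans (le_max_left _ _)) (hR₁ R (le_max_left _ _) k)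
  have h2 := key ν' (le_max_right _ _) (hR₂ R (le_max_right _ _))
  have h3 := hN k hk
  rw [← dist_eq_norm] at h1 h2
  rw [dist_comm] at h2
  have h4 := dist_triangle4 (∫ x, g x ∂(ν k)) (∫ x, φ x ∂(ν k)) (∫ x, φ x ∂ν') (∫ x, g x ∂ν')
  linarith

end DeficientHamiltonian

/-! ### The Hamiltonian velocity fields: formula, uniform bounds, continuity in the measure. -/

namespace DeficientHamiltonian

open Set

variable {d : ℕ} {W Φ : Config d → ℝ}

theorem norm_gradient_sub (f : Config d → ℝ) (x y : Config d) :
    ‖gradient f x - gradient f y‖ = ‖fderiv ℝ f x - fderiv ℝ f y‖ := by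
  rw [gradient, gradient, ← map_sub, LinearIsometryEquiv.norm_map]

theorem norm_gradient (f : Config d → ℝ) (x : Config d) :
    ‖gradient f x‖ = ‖fderiv ℝ f x‖ := by
  rw [gradient, LinearIsometryEquiv.norm_map]

theorem continuous_gradient (hΦ : ContDiff ℝ 2 Φ) : Continuous (gradient Φ) :=
  (InnerProductSpace.toDual ℝ (Config d)).symm.continuous.comp
    (hΦ.continuous_fderiv two_ne_zero)

theorem exists_norm_gradient_le (hW : ContDiff ℝ 2 W) (hs : HasCompactSupport W) :
    ∃ B, ∀ q, ‖gradient W q‖ ≤ B := by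
  obtain ⟨B, hB⟩ := (hs.fderiv ℝ).exists_bound_of_continuous (hW.continuous_fderiv two_ne_zero)
  exact ⟨B, fun q => by rw [norm_gradient]; exact hB q⟩

theorem hasGradientAt_meanField (hW : ContDiff ℝ 2 W) (hs : HasCompactSupport W)
    (ν : Measure (Phase d)) [IsFiniteMeasure ν] (q : Config d) :
    HasGradientAt (meanField W ν) (∫ y, gradient W (q - y.snd) ∂ν) q := by
  obtain ⟨B, hB⟩ := exists_norm_gradient_le hW hs
  obtain ⟨B₀, hB₀⟩ := hs.exists_bound_of_continuous hW.continuous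
  have hg : Continuous fun y : Phase d => fderiv ℝ W (q - y.snd) :=
    (hW.continuous_fderiv two_ne_zero).comp (by fun_prop)
  have key := hasFDerivAt_integral_of_dominated_of_fderiv_le (μ := ν) (𝕜 := ℝ)
    (F := fun q (y : Phase d) => W (q - y.snd)) (F' := fun q y => fderiv ℝ W (q - y.snd))
    (x₀ := q) (s := univ) (bound := fun _ => B) univ_mem
    (Eventually.of_forall fun q => (hW.continuous.comp
      (by fun_prop : Continuous fun y : Phase d => q - y.snd)).aestronglyMeasurable)
    (Integrable.of_bound (hW.continuous.comp
      (by fun_prop : Continuous fun y : Phase d => q - y.snd)).aestronglyMeasurable B₀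
      (Eventually.of_forall fun y => hB₀ _))
    hg.aestronglyMeasurable
    (Eventually.of_forall fun y q _ => by rw [← norm_gradient]; exact hB _)
    (integrable_const B)
    (Eventually.of_forall fun y q _ => by
      have := (hW.differentiable two_ne_zero (q - y.snd)).hasFDerivAt
      simpa using! this.comp q ((hasFDerivAt_id q).sub_const y.snd))
  rw [hasGradientAt_iff_hasFDerivAt]
  have hgi : Integrable (fun y : Phase d => gradient W (q - y.snd)) ν :=
    Integrable.of_bound ((continuous_gradient hW).comp (by fun_prop)).aestronglyMeasurable B
      (Eventually.of_forall fun y => hB _)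
  have hfi : Integrable (fun y : Phase d => fderiv ℝ W (q - y.snd)) ν :=
    Integrable.of_bound hg.aestronglyMeasurable B
      (Eventually.of_forall fun y => by rw [← norm_gradient]; exact hB _)
  -- The Riesz map commutes with the integral, as seen by testing against a vector.
  have e : InnerProductSpace.toDual ℝ (Config d) (∫ y, gradient W (q - y.snd) ∂ν) =
      ∫ y, fderiv ℝ W (q - y.snd) ∂ν := by
    ext w
    rw [InnerProductSpace.toDual_apply_apply, ContinuousLinearMap.integral_apply hfi, real_inner_comm,
      ← integral_inner hgi]
    refine integral_congr_ae (Eventually.of_forall fun y => ?_)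
    simp only [← toDual_gradient, InnerProductSpace.toDual_apply_apply]
    exact real_inner_comm _ _
  rw [e]
  exact key

theorem hamVelocity_eq (hW : ContDiff ℝ 2 W) (hs : HasCompactSupport W) (hΦ : ContDiff ℝ 2 Φ)
    (ν : Measure (Phase d)) [IsFiniteMeasure ν] (x : Phase d) :
    hamVelocity W Φ ν x =
      WithLp.toLp 2 (-((∫ y, gradient W (x.snd - y.snd) ∂ν) + gradient Φ x.snd), x.fst) := by
  have h1 := hasGradientAt_meanField hW hs ν x.snd
  have h2 := (hΦ.differentiable two_ne_zero x.snd).hasGradientAt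
  have h3 : HasGradientAt (fun q => meanField W ν q + Φ q)
      ((∫ y, gradient W (x.snd - y.snd) ∂ν) + gradient Φ x.snd) x.snd := by
    rw [hasGradientAt_iff_hasFDerivAt] at h1 h2 ⊢
    rw [map_add]
    exact h1.add h2
  rw [hamVelocity, wassersteinGradient, h3.gradient]
  rfl

theorem norm_toLp_le (a b : Config d) : ‖(WithLp.toLp 2 (a, b) : Phase d)‖ ≤ ‖a‖ + ‖b‖ := by
  have : (WithLp.toLp 2 (a, b) : Phase d) = WithLp.toLp 2 (a, 0) + WithLp.toLp 2 (0, b) := by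
    rw [← WithLp.toLp_add]; simp
  rw [this]
  refine (norm_add_le _ _).trans (le_of_eq ?_)
  rw [WithLp.norm_toLp_fst, WithLp.norm_toLp_snd]

/-- Bounds and Lipschitz constants on balls for the velocity fields, depending on the measure only
through its mass. -/
theorem exists_hamVelocity_bounds (hW : ContDiff ℝ 2 W) (hs : HasCompactSupport W)
    (hΦ : ContDiff ℝ 2 Φ) {M : ℝ} (hM : 0 ≤ M) :
    ∃ C K : ℝ → ℝ, (∀ R, 0 ≤ C R) ∧ (∀ R, 0 ≤ K R) ∧
      ∀ (ν : Measure (Phase d)) [IsFiniteMeasure ν], ν.real univ ≤ M → ∀ R x, ‖x‖ ≤ R →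
        ‖hamVelocity W Φ ν x‖ ≤ C R ∧ ∀ y, ‖y‖ ≤ R →
          ‖hamVelocity W Φ ν x - hamVelocity W Φ ν y‖ ≤ K R * ‖x - y‖ := by
  obtain ⟨B, hB⟩ := exists_norm_gradient_le hW hs
  have hB0 : 0 ≤ B := (norm_nonneg _).trans (hB 0)
  obtain ⟨L, hL⟩ := ContDiff.lipschitzWith_of_hasCompactSupport (hs.fderiv ℝ)
    (hW.fderiv_right (m := 1) (by norm_num)) one_ne_zero
  have hL' : ∀ x y, ‖gradient W x - gradient W y‖ ≤ L * ‖x - y‖ := fun x y => by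
    rw [norm_gradient_sub]; exact hL.norm_sub_le x y
  have hΦB : ∀ R : ℝ, ∃ b, ∀ q ∈ Metric.closedBall (0 : Config d) R, ‖gradient Φ q‖ ≤ b := fun R =>
    (isCompact_closedBall 0 R).exists_bound_of_continuousOn (continuous_gradient hΦ).continuousOn
  have hΦL : ∀ R : ℝ, ∃ k : NNReal, LipschitzOnWith k (fderiv ℝ Φ) (Metric.closedBall 0 R) :=
    fun R => ((hΦ.fderiv_right (m := 1) (by norm_num)).locallyLipschitz.locallyLipschitzOn
      ).exists_lipschitzOnWith_of_compact (isCompact_closedBall 0 R)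
  choose b hb using hΦB
  choose k hk using hΦL
  -- The summands come from `∇(W * ν)`, from `∇Φ` on the ball, and from the component `p`. Absolute
  -- values give nonnegativity even for negative `R`.
  refine ⟨fun R => M * B + |b R| + |R|, fun R => M * L + k R + 1, fun R => by positivity,
    fun R => by positivity, fun ν _ hν R x hx => ⟨?_, fun y hy => ?_⟩⟩
  · rw [hamVelocity_eq hW hs hΦ]
    refine (norm_toLp_le _ _).trans ?_
    rw [norm_neg]
    have h1 : ‖∫ y, gradient W (x.snd - y.snd) ∂ν‖ ≤ M * B := by
      refine (norm_integral_le_of_norm_le_const (Eventually.of_forall fun y => hB _)).trans ?_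
      rw [mul_comm]
      gcongr
    have h2 := hb R x.snd (by simpa using (WithLp.norm_snd_le _ x).trans hx)
    have h3 := (WithLp.norm_fst_le _ x).trans hx
    linarith [norm_add_le (∫ y, gradient W (x.snd - y.snd) ∂ν) (gradient Φ x.snd),
      le_abs_self (b R), le_abs_self R]
  · rw [hamVelocity_eq hW hs hΦ, hamVelocity_eq hW hs hΦ, ← WithLp.toLp_sub, Prod.mk_sub_mk]
    refine (norm_toLp_le _ _).trans ?_
    have hi : ∀ q, Integrable (fun z : Phase d => gradient W (q - z.snd)) ν := fun q =>
      Integrable.of_bound ((continuous_gradient hW).comp (by fun_prop)).aestronglyMeasurable B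
        (Eventually.of_forall fun y => hB _)
    have hsnd : ‖x.snd - y.snd‖ ≤ ‖x - y‖ := WithLp.norm_snd_le _ (x - y)
    have hfst : ‖x.fst - y.fst‖ ≤ ‖x - y‖ := WithLp.norm_fst_le _ (x - y)
    have h1 : ‖(∫ z, gradient W (x.snd - z.snd) ∂ν) - ∫ z, gradient W (y.snd - z.snd) ∂ν‖ ≤
        M * L * ‖x - y‖ := by
      rw [← integral_sub (hi _) (hi _)]
      refine (norm_integral_le_of_norm_le_const (C := L * ‖x - y‖)
        (Eventually.of_forall fun z => ?_)).trans ?_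
      · refine (hL' _ _).trans ?_
        rw [sub_sub_sub_cancel_right]
        gcongr
      · rw [mul_comm, mul_assoc]
        gcongr
    have h2 : ‖gradient Φ x.snd - gradient Φ y.snd‖ ≤ k R * ‖x - y‖ := by
      rw [norm_gradient_sub]
      refine ((hk R).norm_sub_le (by simpa using (WithLp.norm_snd_le _ x).trans hx)
        (by simpa using (WithLp.norm_snd_le _ y).trans hy)).trans ?_
      gcongr
    have e : ∀ a b c e : Config d, -(a + b) - -(c + e) = -((a - c) + (b - e)) := fun _ _ _ _ => by
      abel
    rw [e, norm_neg]
    refine (add_le_add (norm_add_le _ _) hfst).trans ?_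
    linarith

/-- The integrand `z ↦ ∇W(q - z.snd)` does not depend on `z.fst`, so it need not have compact
support, and tightness is what makes it admissible. Coordinates reduce to real-valued integrands. -/
theorem tendsto_hamVelocity (hW : ContDiff ℝ 2 W) (hs : HasCompactSupport W)
    (hΦ : ContDiff ℝ 2 Φ) {ν : ℕ → Measure (Phase d)} {ν' : Measure (Phase d)}
    [∀ k, IsFiniteMeasure (ν k)] [IsFiniteMeasure ν'] (h : DistribTendsto ν ν') {M : ℝ}
    (hM : ∀ k, (ν k).real univ ≤ M)
    (htail : ∀ η > 0, ∃ R, ∀ R' ≥ R, ∀ k, (ν k).real {x | R' < ‖x‖} ≤ η) (x : Phase d) :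
    Tendsto (fun k => hamVelocity W Φ (ν k) x) atTop (𝓝 (hamVelocity W Φ ν' x)) := by
  obtain ⟨B, hB⟩ := exists_norm_gradient_le hW hs
  have hc : Continuous fun z : Phase d => gradient W (x.snd - z.snd) :=
    (continuous_gradient hW).comp (by fun_prop)
  have hi : ∀ (m : Measure (Phase d)) [IsFiniteMeasure m],
      Integrable (fun z : Phase d => gradient W (x.snd - z.snd)) m := fun m _ =>
    Integrable.of_bound hc.aestronglyMeasurable B (Eventually.of_forall fun y => hB _)
  have key : Tendsto (fun k => ∫ z, gradient W (x.snd - z.snd) ∂(ν k)) atTop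
      (𝓝 (∫ z, gradient W (x.snd - z.snd) ∂ν')) := by
    have hco : ∀ i : Fin d, Tendsto (fun k => (∫ z, gradient W (x.snd - z.snd) ∂(ν k)) i) atTop
        (𝓝 ((∫ z, gradient W (x.snd - z.snd) ∂ν') i)) := fun i => by
      have e : ∀ (m : Measure (Phase d)) [IsFiniteMeasure m],
          (∫ z, gradient W (x.snd - z.snd) ∂m) i = ∫ z, gradient W (x.snd - z.snd) i ∂m :=
        fun m _ => ((EuclideanSpace.proj i : Config d →L[ℝ] ℝ).integral_comp_comm (hi m)).symm
      simp only [e]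
      exact h.tendsto_integral hM htail
        ((EuclideanSpace.proj i : Config d →L[ℝ] ℝ).continuous.comp hc)
        fun z => (PiLp.norm_apply_le _ i).trans (hB _)
    have := ((PiLp.continuous_toLp 2 (fun _ : Fin d => ℝ)).tendsto _).comp (tendsto_pi_nhds.2 hco)
    exact this
  simp only [hamVelocity_eq hW hs hΦ]
  have hcont : Continuous fun a : Config d =>
      (WithLp.toLp 2 (-(a + gradient Φ x.snd), x.fst) : Phase d) :=
    (WithLp.prod_continuous_toLp 2 _ _).comp (by fun_prop)
  exact (hcont.tendsto _).comp key

end DeficientHamiltonian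

/-! ### The discretization as one transport of `μ₀`, and its limit. -/

namespace DeficientHamiltonian

open Set

variable {d : ℕ} {W Φ : Config d → ℝ} {C K : ℝ → ℝ} {ε h T t : ℝ} {μ₀ : Measure (Phase d)}

theorem isSolutionOn_zero (v : ℝ → Phase d → Phase d) (x : Phase d) :
    IsSolutionOn v x 0 fun _ => x where
  continuousOn := continuousOn_const
  intervalIntegrable := IntervalIntegrable.refl
  eq_integral s hs := by
    have : s = 0 := le_antisymm hs.2 hs.1
    simp [this]

theorem deficientTransport_zero {v : ℝ → Phase d → Phase d} (hv : LocallyControlled v C K)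
    (ν : Measure (Phase d)) : deficientTransport v ε 0 ν = ν := by
  refine Measure.ext_of_lintegral _ fun ψ hψ => ?_
  have hS : survivors v 0 = univ := eq_univ_of_forall fun x => ⟨_, isSolutionOn_zero v x⟩
  rw [lintegral_deficientTransport hv le_rfl ν hψ, hS, Measure.restrict_univ]
  refine lintegral_congr fun x => ?_
  rw [flow_eq hv le_rfl (isSolutionOn_zero v x)]
  simp [weightAlongFlow]

theorem gridMeasure_univ_le (hε : 0 ≤ ε) (hh : 0 ≤ h) (k : ℕ) :
    gridMeasure W Φ ε h μ₀ k univ ≤ μ₀ univ := by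
  induction k with
  | zero => exact le_rfl
  | succ k ih => exact (deficientTransport_univ_le hε hh _ _).trans ih

theorem isFiniteMeasure_gridMeasure [IsFiniteMeasure μ₀] (hε : 0 ≤ ε) (hh : 0 ≤ h) (k : ℕ) :
    IsFiniteMeasure (gridMeasure W Φ ε h μ₀ k) :=
  ⟨(gridMeasure_univ_le hε hh k).trans_lt (measure_lt_top _ _)⟩

theorem gridMeasure_real_univ_le [IsFiniteMeasure μ₀] (hε : 0 ≤ ε) (hh : 0 ≤ h) (k : ℕ) :
    (gridMeasure W Φ ε h μ₀ k).real univ ≤ μ₀.real univ :=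
  ENNReal.toReal_mono (measure_ne_top _ _) (gridMeasure_univ_le hε hh k)

variable (W Φ ε h μ₀) in
/-- The piecewise constant in time velocity field of the discretization with step `h`. -/
noncomputable def stepField (s : ℝ) : Phase d → Phase d :=
  hamVelocity W Φ (gridMeasure W Φ ε h μ₀ ⌊s / h⌋₊)

/-- All velocity fields of measures of mass at most `M` obey the bounds `C` and `K`. -/
def VelocityBounds (W Φ : Config d → ℝ) (M : ℝ) (C K : ℝ → ℝ) : Prop :=
  (∀ R, 0 ≤ C R) ∧ (∀ R, 0 ≤ K R) ∧
    ∀ (ν : Measure (Phase d)) [IsFiniteMeasure ν], ν.real univ ≤ M → ∀ R x, ‖x‖ ≤ R →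
      ‖hamVelocity W Φ ν x‖ ≤ C R ∧ ∀ y, ‖y‖ ≤ R →
        ‖hamVelocity W Φ ν x - hamVelocity W Φ ν y‖ ≤ K R * ‖x - y‖

theorem VelocityBounds.locallyControlled {M : ℝ} (hb : VelocityBounds W Φ M C K)
    (ν : Measure (Phase d)) [IsFiniteMeasure ν] (hν : ν.real univ ≤ M) :
    LocallyControlled (fun _ => hamVelocity W Φ ν) C K where
  measurable _ := measurable_const
  bound R _ x hx := (hb.2.2 ν hν R x hx).1
  lipschitz R _ x y hx hy := (hb.2.2 ν hν R x hx).2 y hy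
  nonneg := hb.2.1

theorem VelocityBounds.locallyControlled_gridMeasure [IsFiniteMeasure μ₀]
    (hb : VelocityBounds W Φ (μ₀.real univ) C K) (hε : 0 ≤ ε) (hh : 0 ≤ h) (k : ℕ) :
    LocallyControlled (fun _ => hamVelocity W Φ (gridMeasure W Φ ε h μ₀ k)) C K :=
  have := isFiniteMeasure_gridMeasure (W := W) (Φ := Φ) (μ₀ := μ₀) hε hh k
  hb.locallyControlled _ (gridMeasure_real_univ_le hε hh k)

theorem VelocityBounds.locallyControlled_stepField [IsFiniteMeasure μ₀]
    (hb : VelocityBounds W Φ (μ₀.real univ) C K) (hε : 0 ≤ ε) (hh : 0 ≤ h) :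
    LocallyControlled (stepField W Φ ε h μ₀) C K where
  measurable x := (measurable_from_nat (f := fun k =>
    hamVelocity W Φ (gridMeasure W Φ ε h μ₀ k) x)).comp
      (Nat.measurable_floor.comp (measurable_id.div_const h))
  bound R s := (hb.locallyControlled_gridMeasure hε hh ⌊s / h⌋₊).bound R s
  lipschitz R s := (hb.locallyControlled_gridMeasure hε hh ⌊s / h⌋₊).lipschitz R s
  nonneg := hb.2.1

theorem stepField_eq (hh : 0 < h) (k : ℕ) {r : ℝ} (hr : r ∈ Ico 0 h) :
    stepField W Φ ε h μ₀ (k * h + r) = hamVelocity W Φ (gridMeasure W Φ ε h μ₀ k) := by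
  have : ⌊(k * h + r) / h⌋₊ = k := by
    rw [add_div, mul_div_cancel_right₀ _ hh.ne', add_comm, Nat.floor_add_natCast
      (div_nonneg hr.1 hh.le), Nat.floor_eq_zero.2 ((div_lt_one hh).2 hr.2), zero_add]
  rw [stepField, this]

/-- The endpoint `r = h` is allowed because fields are compared only on `Ico 0 r`. Hence the lemma
both completes a grid step and treats times inside it. -/
theorem deficientTransport_stepField_add [IsFiniteMeasure μ₀]
    (hb : VelocityBounds W Φ (μ₀.real univ) C K) (hε : 0 ≤ ε) (hh : 0 < h) (k : ℕ) {r : ℝ}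
    (hr : r ∈ Icc 0 h)
    (hk : gridMeasure W Φ ε h μ₀ k = deficientTransport (stepField W Φ ε h μ₀) ε (k * h) μ₀) :
    deficientTransport (fun _ => hamVelocity W Φ (gridMeasure W Φ ε h μ₀ k)) ε r
      (gridMeasure W Φ ε h μ₀ k) =
        deficientTransport (stepField W Φ ε h μ₀) ε (k * h + r) μ₀ := by
  have h1 : deficientTransport (fun _ => hamVelocity W Φ (gridMeasure W Φ ε h μ₀ k)) ε r
      (gridMeasure W Φ ε h μ₀ k) = deficientTransport
        (fun s => stepField W Φ ε h μ₀ (k * h + s)) ε r (gridMeasure W Φ ε h μ₀ k) :=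
    deficientTransport_congr hr.1 (fun s hs =>
      (stepField_eq hh k ⟨hs.1, hs.2.trans_le hr.2⟩).symm) _
  rw [h1, hk, deficientTransport_deficientTransport
    (hb.locallyControlled_stepField hε hh.le) (by positivity) hr.1]

theorem gridMeasure_eq [IsFiniteMeasure μ₀] (hb : VelocityBounds W Φ (μ₀.real univ) C K)
    (hε : 0 ≤ ε) (hh : 0 < h) (k : ℕ) :
    gridMeasure W Φ ε h μ₀ k = deficientTransport (stepField W Φ ε h μ₀) ε (k * h) μ₀ := by
  induction k with
  | zero =>
    rw [Nat.cast_zero, zero_mul, deficientTransport_zero (hb.locallyControlled_stepField hε hh.le)]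
    rfl
  | succ k ih =>
    rw [Nat.cast_succ, add_mul, one_mul, ← deficientTransport_stepField_add hb hε hh k
      ⟨hh.le, le_rfl⟩ ih]
    rfl

theorem sub_floor_mul_mem_Ico (hh : 0 < h) (ht : 0 ≤ t) : t - ⌊t / h⌋₊ * h ∈ Ico 0 h := by
  have h1 := (le_div_iff₀ hh).1 (Nat.floor_le (div_nonneg ht hh.le))
  have h2 := (div_lt_iff₀ hh).1 (Nat.lt_floor_add_one (t / h))
  constructor <;> linarith

/-- The base measure `μ₀` no longer varies with `n`, so the limit in `n` involves only the fields.
-/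
theorem discretized_eq [IsFiniteMeasure μ₀] (hb : VelocityBounds W Φ (μ₀.real univ) C K)
    (hε : 0 ≤ ε) (hT : 0 < T) {n : ℕ} (hn : 0 < n) (ht : 0 ≤ t) :
    discretized W Φ ε T μ₀ n t = deficientTransport (stepField W Φ ε (T / n) μ₀) ε t μ₀ := by
  have hh : 0 < T / n := by positivity
  have hm := sub_floor_mul_mem_Ico hh ht
  have := deficientTransport_stepField_add hb hε hh ⌊t / (T / n)⌋₊ (Ico_subset_Icc_self hm)
    (gridMeasure_eq hb hε hh _)
  rw [add_sub_cancel] at this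
  exact this

theorem expMoment_mono {α β : ℝ} (h : α ≤ β) (ν : Measure (Phase d)) :
    expMoment α ν ≤ expMoment β ν :=
  lintegral_mono fun _ => ENNReal.ofReal_le_ofReal (Real.exp_le_exp.2
    (mul_le_mul_of_nonneg_right h (norm_nonneg _)))

theorem expMoment_gridMeasure_le [IsFiniteMeasure μ₀]
    (hb : VelocityBounds W Φ (μ₀.real univ) C K) {α : ℝ} (hα : 0 ≤ α) (hαε : α ≤ ε)
    (hh : 0 ≤ h) (k : ℕ) : expMoment α (gridMeasure W Φ ε h μ₀ k) ≤ expMoment α μ₀ := by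
  induction k with
  | zero => exact le_rfl
  | succ k ih =>
    exact (expMoment_deficientTransport_le
      (hb.locallyControlled_gridMeasure (hα.trans hαε) hh k) hh hα hαε _).trans ih

/-- The discretized measures and the measures at the preceding grid points have the same limits
in the sense of distributions. -/
theorem distribTendsto_gridMeasure [IsFiniteMeasure μ₀]
    (hb : VelocityBounds W Φ (μ₀.real univ) C K) (hε : 0 ≤ ε) (hT : 0 < T) {n : ℕ → ℕ}
    (hn0 : ∀ k, 0 < n k) (hn : Tendsto n atTop atTop) (ht : 0 ≤ t) {ν : Measure (Phase d)}
    (hν : DistribTendsto (fun k => discretized W Φ ε T μ₀ (n k) t) ν) :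
    DistribTendsto (fun k => gridMeasure W Φ ε (T / n k) μ₀ ⌊t / (T / n k)⌋₊) ν := by
  intro φ hφ hφc
  obtain ⟨L, hL⟩ := ContDiff.lipschitzWith_of_hasCompactSupport hφc hφ (by simp)
  obtain ⟨B, hB⟩ := hφc.exists_bound_of_continuous hφ.continuous
  have hB0 : 0 ≤ B := (norm_nonneg _).trans (hB 0)
  obtain ⟨r₀, hr₀⟩ := hφc.isCompact.isBounded.subset_closedBall 0
  set r := max r₀ 0
  have hφ0 : ∀ x, r < ‖x‖ → φ x = 0 := fun x hx => by
    by_contra hne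
    have := hr₀ (subset_tsupport φ (Function.mem_support.2 hne))
    rw [mem_closedBall_zero_iff] at this
    exact absurd hx (not_lt.2 (this.trans (le_max_left _ _)))
  have hstep : Tendsto (fun k => T / (n k : ℝ)) atTop (𝓝 0) :=
    tendsto_const_nhds.div_atTop (tendsto_natCast_atTop_atTop.comp hn)
  have hstepC : Tendsto (fun k => C (r + 2) * (T / (n k : ℝ))) atTop (𝓝 0) := by
    simpa using hstep.const_mul (C (r + 2))
  have hC := hb.1 (r + 2)
  have hdiff : Tendsto (fun k => ∫ y, φ y ∂(discretized W Φ ε T μ₀ (n k) t) -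
      ∫ y, φ y ∂(gridMeasure W Φ ε (T / n k) μ₀ ⌊t / (T / n k)⌋₊)) atTop (𝓝 0) := by
    refine squeeze_zero_norm' (a := fun k =>
      (L + B * ε) * (C (r + 2) * (T / n k)) * μ₀.real univ) ?_ ?_
    · filter_upwards [hstepC.eventually_lt_const one_pos] with k hk
      have hh : 0 < T / (n k : ℝ) := div_pos hT (Nat.cast_pos.2 (hn0 k))
      have hm := sub_floor_mul_mem_Ico hh ht
      have hle := mul_le_mul_of_nonneg_left hm.2.le hC
      have := isFiniteMeasure_gridMeasure (W := W) (Φ := Φ) (μ₀ := μ₀) hε hh.le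
        ⌊t / (T / n k)⌋₊
      refine (norm_integral_deficientTransport_sub_le
        (hb.locallyControlled_gridMeasure hε hh.le _) hm.1 hε _ hL hB (le_max_right r₀ 0) hφ0
        (hle.trans_lt hk)).trans ?_
      refine mul_le_mul (mul_le_mul_of_nonneg_left hle (by positivity))
        (gridMeasure_real_univ_le hε hh.le _) measureReal_nonneg (by positivity)
    · simpa using (hstepC.const_mul (L + B * ε)).mul_const (μ₀.real univ)
  simpa using (hν φ hφ hφc).sub hdiff

theorem tendsto_stepField [IsFiniteMeasure μ₀] (hW : ContDiff ℝ 2 W) (hs : HasCompactSupport W)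
    (hΦ : ContDiff ℝ 2 Φ) (hb : VelocityBounds W Φ (μ₀.real univ) C K) (hε : 0 < ε) {α₀ : ℝ}
    (hα₀ : 0 < α₀) (hμ₀ : expMoment α₀ μ₀ < ⊤) (hT : 0 < T) {n : ℕ → ℕ}
    (hn0 : ∀ k, 0 < n k) (hn : Tendsto n atTop atTop) (ht : 0 ≤ t) {ν : Measure (Phase d)}
    [IsFiniteMeasure ν] (hν : DistribTendsto (fun k => discretized W Φ ε T μ₀ (n k) t) ν)
    (x : Phase d) :
    Tendsto (fun k => stepField W Φ ε (T / n k) μ₀ t x) atTop (𝓝 (hamVelocity W Φ ν x)) := by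
  have hh : ∀ k, 0 < T / (n k : ℝ) := fun k => div_pos hT (Nat.cast_pos.2 (hn0 k))
  have := fun k => isFiniteMeasure_gridMeasure (W := W) (Φ := Φ) (μ₀ := μ₀) hε.le (hh k).le
    ⌊t / (T / n k)⌋₊
  refine tendsto_hamVelocity hW hs hΦ
    (distribTendsto_gridMeasure hb hε.le hT hn0 hn ht hν)
    (fun k => gridMeasure_real_univ_le hε.le (hh k).le _) (fun η hη => ?_) x
  -- `α ≤ α₀` makes the initial moment finite; `α ≤ ε` lets the loss of mass propagate it.
  set α := min α₀ ε
  have hα : 0 < α := lt_min hα₀ hε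
  set m := (expMoment α μ₀).toReal
  have hm : expMoment α μ₀ = ENNReal.ofReal m :=
    (ENNReal.ofReal_toReal ((expMoment_mono (min_le_left _ _) μ₀).trans_lt hμ₀).ne).symm
  have hlim : Tendsto (fun R => Real.exp (-(α * R)) * m) atTop (𝓝 0) := by
    simpa using (Real.tendsto_exp_neg_atTop_nhds_zero.comp
      (tendsto_id.const_mul_atTop hα)).mul_const m
  obtain ⟨R, hR⟩ := eventually_atTop.1 (hlim.eventually_le_const hη)
  exact ⟨R, fun R' hR' k => (measureReal_norm_gt_le _ hα.le ENNReal.toReal_nonneg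
    ((expMoment_gridMeasure_le hb hα.le (min_le_right _ _) (hh k).le _).trans_eq hm)).trans
      (hR R' hR')⟩

/-- Stability of deficient transport: mass that escapes to infinity in the limit is annihilated
by the degradation weight. -/
theorem tendsto_integral_deficientTransport {v : ℝ → Phase d → Phase d}
    {w : ℕ → ℝ → Phase d → Phase d} (hw : ∀ i, LocallyControlled (w i) C K)
    (hv : LocallyControlled v C K) (ht : 0 ≤ t) (hε : 0 < ε)
    (h : ∀ s ∈ Icc 0 t, ∀ x, Tendsto (fun i => w i s x) atTop (𝓝 (v s x))) [IsFiniteMeasure μ₀]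
    {φ : Phase d → ℝ} (hφ : Continuous φ) {B : ℝ} (hB : ∀ x, ‖φ x‖ ≤ B) :
    Tendsto (fun i => ∫ y, φ y ∂(deficientTransport (w i) ε t μ₀)) atTop
      (𝓝 (∫ y, φ y ∂(deficientTransport v ε t μ₀))) := by
  have hB0 : 0 ≤ B := (norm_nonneg _).trans (hB 0)
  have e : ∀ u, LocallyControlled u C K → ∫ y, φ y ∂(deficientTransport u ε t μ₀) =
      ∫ x, (survivors u t).indicator (fun x => φ (flow u t x) * weightAlongFlow u ε t x) x ∂μ₀ :=
    fun u hu => by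
      rw [integral_deficientTransport hu ht _ hφ,
        integral_indicator (isOpen_survivors hu ht).measurableSet]
  simp only [e _ (hw _), e v hv]
  have hbd : ∀ u x, ‖φ (flow u t x) * weightAlongFlow u ε t x‖ ≤
      B * weightAlongFlow u ε t x := fun u x => by
    rw [norm_mul, Real.norm_of_nonneg (weightAlongFlow_nonneg _ _ _ _)]
    exact mul_le_mul_of_nonneg_right (hB _) (weightAlongFlow_nonneg _ _ _ _)
  refine tendsto_integral_of_dominated_convergence (fun _ => B) (fun i => ?_)
    (integrable_const B) (fun i => Eventually.of_forall fun x => ?_)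
    (Eventually.of_forall fun x => ?_)
  · exact ((integrableOn_comp_flow_mul_weight (hw i) ht hε.le μ₀ hφ hB).integrable_indicator
      (isOpen_survivors (hw i) ht).measurableSet).aestronglyMeasurable
  · refine (norm_indicator_le_norm_self _ _).trans ((hbd _ x).trans ?_)
    exact mul_le_of_le_one_right hB0 (weightAlongFlow_le_one hε.le ht _ _)
  by_cases hx : x ∈ survivors v t
  · rw [indicator_of_mem hx]
    have hlim := ((hφ.tendsto _).comp (tendsto_flow hw hv ht h (tendsto_const_nhds (x := x)) hx t
      ⟨ht, le_rfl⟩)).mul (tendsto_weightAlongFlow (ε := ε) hw hv ht h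
        (tendsto_const_nhds (x := x)) hx)
    refine hlim.congr' ?_
    filter_upwards [eventually_mem_survivors_and_norm_sub_le hw hv ht h
      (tendsto_const_nhds (x := x)) hx one_pos] with i hi
    rw [indicator_of_mem hi.1]
    rfl
  · rw [indicator_of_notMem hx, Metric.tendsto_nhds]
    intro δ hδ
    have hexp : Tendsto (fun R => B * Real.exp (-(ε * R))) atTop (𝓝 0) := by
      simpa using (Real.tendsto_exp_neg_atTop_nhds_zero.comp
        (tendsto_id.const_mul_atTop hε)).const_mul B
    -- A trajectory from `x` that reaches norm `‖x‖ + R` has length at least `R`, so its weight is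
    -- at most `exp (-(ε * R))`.
    obtain ⟨R, hR⟩ := (hexp.eventually_lt_const hδ).exists
    filter_upwards [eventually_exists_lt_norm_flow hw hv ht h hx (‖x‖ + R)] with i hi
    rw [dist_zero_right]
    by_cases hxi : x ∈ survivors (w i) t
    · obtain ⟨s, hs, hRs⟩ := hi hxi
      rw [indicator_of_mem hxi]
      refine (hbd _ x).trans_lt (lt_of_le_of_lt (mul_le_mul_of_nonneg_left ?_ hB0) hR)
      have hX := isSolutionOn_flow (hw i) ht hxi
      rw [weightAlongFlow_eq (hw i) ht hX, Real.exp_le_exp, neg_le_neg_iff]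
      refine mul_le_mul_of_nonneg_left (le_trans ?_ (hX.norm_sub_le_integral_norm hs)) hε.le
      linarith [norm_le_norm_add_norm_sub' (flow (w i) s x) x]
    · rw [indicator_of_notMem hxi, norm_zero]
      exact hδ

end DeficientHamiltonian

/-! ### The representation formula for the limit measures. -/

open Set DeficientHamiltonian

theorem mainTheorem7 (d : ℕ)
    (W Φ : EuclideanSpace ℝ (Fin d) → ℝ)
    (hW : ContDiff ℝ 2 W) (hW_supp : HasCompactSupport W) (hW_even : ∀ q, W (-q) = W q)
    (hΦ : ContDiff ℝ 2 Φ)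
    (α₀ ε T : ℝ) (hα₀ : 0 < α₀) (hε : 0 < ε) (hT : 0 < T)
    (μ₀ : Measure (DeficientHamiltonian.Phase d)) [IsFiniteMeasure μ₀]
    (hμ₀ : DeficientHamiltonian.expMoment α₀ μ₀ < ⊤)
    (μ : ℝ → Measure (DeficientHamiltonian.Phase d))
    (hμ : DeficientHamiltonian.IsConstructedSolution W Φ ε T μ₀ μ)
    (v : ℝ → DeficientHamiltonian.Phase d → DeficientHamiltonian.Phase d)
    (hv : v = fun s => DeficientHamiltonian.hamVelocity W Φ (μ s))
    (t : ℝ) (ht : 0 < t) (htT : t ≤ T) :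
    IsOpen (DeficientHamiltonian.survivors v t) ∧
      ∀ φ : DeficientHamiltonian.Phase d → ℝ, ContDiff ℝ ∞ φ → HasCompactSupport φ →
        IntegrableOn
            (fun x => φ (DeficientHamiltonian.flow v t x) *
              DeficientHamiltonian.weightAlongFlow v ε t x)
            (DeficientHamiltonian.survivors v t) μ₀ ∧
          ∫ y, φ y ∂(μ t) =
            ∫ x in DeficientHamiltonian.survivors v t,
              φ (DeficientHamiltonian.flow v t x) *
                DeficientHamiltonian.weightAlongFlow v ε t x ∂μ₀ := by
  obtain ⟨hfin, n', hn', hlim'⟩ := hμ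
  -- Strict monotonicity allows `n' 0 = 0`, for which the step `T / 0` is `0`; dropping the first
  -- term makes all steps positive.
  set n : ℕ → ℕ := fun k => n' (k + 1)
  have hn0 : ∀ k, 0 < n k := fun k => (Nat.succ_pos k).trans_le (hn'.le_apply)
  have hn : Tendsto n atTop atTop := hn'.tendsto_atTop.comp (tendsto_add_atTop_nat 1)
  have hlim : ∀ s ∈ Icc 0 T, DistribTendsto (fun k => discretized W Φ ε T μ₀ (n k) s) (μ s) :=
    fun s hs φ hφ hφc => (hlim' s hs φ hφ hφc).comp (tendsto_add_atTop_nat 1)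
  obtain ⟨C, K, hb⟩ : ∃ C K, VelocityBounds W Φ (μ₀.real univ) C K :=
    exists_hamVelocity_bounds hW hW_supp hΦ measureReal_nonneg
  have hh : ∀ k, 0 < T / (n k : ℝ) := fun k => div_pos hT (Nat.cast_pos.2 (hn0 k))
  have hw : ∀ k, LocallyControlled (stepField W Φ ε (T / n k) μ₀) C K := fun k =>
    hb.locallyControlled_stepField hε.le (hh k).le
  have hconv : ∀ s ∈ Icc 0 T, ∀ x,
      Tendsto (fun k => stepField W Φ ε (T / n k) μ₀ s x) atTop (𝓝 (v s x)) := fun s hs x => by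
    have := hfin s hs
    rw [hv]
    exact tendsto_stepField hW hW_supp hΦ hb hε hα₀ hμ₀ hT hn0 hn hs.1 (hlim s hs) x
  -- Outside `[0, T]` the measures `μ s` are arbitrary, so `v` is replaced there by `0`; the objects
  -- at time `t ≤ T` do not change.
  have hu : LocallyControlled ((Icc 0 T).indicator v) C K := by
    refine LocallyControlled.of_tendsto
      (fun k => (hw k).indicator hb.1 (measurableSet_Icc (a := (0 : ℝ)) (b := T))) fun s x => ?_
    by_cases hs : s ∈ Icc 0 T
    · simpa only [indicator_of_mem hs] using hconv s hs x
    · simp only [indicator_of_notMem hs]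
      exact tendsto_const_nhds
  have hIcc : ∀ s ∈ Icc 0 t, s ∈ Icc 0 T := fun s hs => ⟨hs.1, hs.2.trans htT⟩
  have huv : ∀ s ∈ Ico 0 t, v s = (Icc 0 T).indicator v s := fun s hs =>
    (indicator_of_mem (hIcc s (Ico_subset_Icc_self hs)) v).symm
  rw [survivors_congr ht.le huv, flow_congr ht.le huv, weightAlongFlow_congr ht.le huv]
  refine ⟨isOpen_survivors hu ht.le, fun φ hφ hφc => ?_⟩
  obtain ⟨B, hB⟩ := hφc.exists_bound_of_continuous hφ.continuous
  refine ⟨integrableOn_comp_flow_mul_weight hu ht.le hε.le μ₀ hφ.continuous hB, ?_⟩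
  rw [← integral_deficientTransport hu ht.le μ₀ hφ.continuous]
  refine tendsto_nhds_unique (hlim t ⟨ht.le, htT⟩ φ hφ hφc) ?_
  simp only [discretized_eq hb hε.le hT (hn0 _) ht.le]
  refine tendsto_integral_deficientTransport hw hu ht.le hε (fun s hs x => ?_) hφ.continuous hB
  rw [indicator_of_mem (hIcc s hs)]
  exact hconv s (hIcc s hs) x
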